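/- Let $n\ge 3$, let $m>0$ be a real number, and let $(M^n,g,f)$ be a closed generalized $(\lambda,n+m)$-Einstein manifold: $(M,g)$ is a closed (compact, without boundary), connected, smooth $n$-dimensional Riemannian manifold, and $f,\lambda$ are smooth functions on $M$ with $f\not\equiv 0$ and $$Ddf=\frac{f}{m}\,(\mathrm{Ric}-\lambda g).$$ Let $s$ be the scalar curvature, $z=\mathrm{Ric}-\frac sn g$ the traceless Ricci tensor, and let $$T=\frac{1}{n-2}\,df\wedge z+\frac{1}{(n-1)(n-2)}\,i_{\nabla f}z\wedge g ,$$ where $i_{\nabla f}z(X)=z(\nabla f,X)$ and $(\eta\wedge h)(X,Y,Z)=\eta(X)h(Y,Z)-\eta(Y)h(X,Z)$ for a $1$-form $\eta$ and a symmetric $2$-tensor $h$. If $T=0$ on $M$, then the Cotton tensor $$C=d^D\Big(\mathrm{Ric}-\frac{s}{2(n-1)}g\Big),\qquad d^Dh(X,Y,Z)=D_Xh(Y,Z)-D_Yh(X,Z),$$ vanishes on $M$. Moreover $g$ has harmonic Weyl curvature, i.e. $\delta\mathcal W=0$, where $\mathcal W$ is the Weyl tensor and $\delta=-\mathrm{div}$;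 and, if $n\ge 4$, $g$ is Bach-flat, i.e. the Bach tensor $$B=\frac{1}{n-3}\,\delta^D\delta\mathcal W+\frac{1}{n-2}\,\mathring{\mathcal W}z$$ vanishes. Here, for a local orthonormal frame $\{e_i\}$, $(\delta^DA)(X,Y)=-\sum_i(D_{e_i}A)(e_i,X,Y)$ for $A\in\Gamma(\Lambda^2M\otimes T^*M)$, the section $\delta\mathcal W(X,Y,Z)=-\sum_i(D_{e_i}\mathcal W)(e_i,X,Y,Z)$ of $T^*M\otimes\Lambda^2M$ is identified with the section $(Y,Z,X)\mapsto\delta\mathcal W(X,Y,Z)$ of $\Lambda^2M\otimes T^*M$, and $(\mathring{\mathcal W}z)(X,Y)=\sum_{i,j}\mathcal W(X,e_i,Y,e_j)\,z(e_i,e_j)$, with the sign convention that $\mathcal R(X,Y,X,Y)$ is the sectional curvature of an orthonormal pair. -/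

import Mathlib

open scoped Manifold ContDiff

noncomputable section

namespace RiemChart

/-! ### Classical tensor calculus in a coordinate domain of `ℝⁿ`

`G i j : ℝⁿ → ℝ` are the components of a metric in coordinates. Repeated indices are summed,
and indices are raised with the inverse matrix of `G`. All tensors below are covariant. -/

variable {n : ℕ}

/-- Partial derivative `∂ᵢ u`. -/
def partialD (i : Fin n) (u : EuclideanSpace ℝ (Fin n) → ℝ) :
    EuclideanSpace ℝ (Fin n) → ℝ :=
  fun y => fderiv ℝ u y (EuclideanSpace.single i 1)

/-- The inverse metric `g^{kl}`. -/
def invMetric (G : Fin n → Fin n → EuclideanSpace ℝ (Fin n) → ℝ)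
    (k l : Fin n) : EuclideanSpace ℝ (Fin n) → ℝ :=
  fun y => (Matrix.of fun i j => G i j y)⁻¹ k l

/-- Christoffel symbols `Γᵏᵢⱼ` of the Levi-Civita connection: `D_{∂ᵢ} ∂ⱼ = Γᵏᵢⱼ ∂ₖ`. -/
def christoffel (G : Fin n → Fin n → EuclideanSpace ℝ (Fin n) → ℝ)
    (k i j : Fin n) : EuclideanSpace ℝ (Fin n) → ℝ :=
  fun y => (1 / 2) * ∑ l, invMetric G k l y *
    (partialD i (G j l) y + partialD j (G i l) y - partialD l (G i j) y)

/-- Components `Rˡᵢⱼₖ` of the curvature endomorphism: `R(∂ᵢ, ∂ⱼ) ∂ₖ = Rˡᵢⱼₖ ∂ₗ`, where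
`R(X, Y) = [D_X, D_Y] - D_[X, Y]`. -/
def curvEnd (G : Fin n → Fin n → EuclideanSpace ℝ (Fin n) → ℝ)
    (l i j k : Fin n) : EuclideanSpace ℝ (Fin n) → ℝ :=
  fun y => partialD i (christoffel G l j k) y - partialD j (christoffel G l i k) y
    + ∑ p, (christoffel G l i p y * christoffel G p j k y
      - christoffel G l j p y * christoffel G p i k y)

/-- The Riemann tensor `R(X, Y, Z, V) = g(R(X, Y) V, Z)`; on an orthonormal pair
`R(X, Y, X, Y)` is the sectional curvature. -/
def riemann (G : Fin n → Fin n → EuclideanSpace ℝ (Fin n) → ℝ)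
    (i j k l : Fin n) : EuclideanSpace ℝ (Fin n) → ℝ :=
  fun y => ∑ p, G k p y * curvEnd G p i j l y

/-- The Ricci tensor `Ric(Y, Z)`, the trace of `X ↦ R(X, Y) Z`. -/
def ricci (G : Fin n → Fin n → EuclideanSpace ℝ (Fin n) → ℝ)
    (j k : Fin n) : EuclideanSpace ℝ (Fin n) → ℝ :=
  fun y => ∑ i, curvEnd G i i j k y

/-- The scalar curvature `s`. -/
def scalar (G : Fin n → Fin n → EuclideanSpace ℝ (Fin n) → ℝ) :
    EuclideanSpace ℝ (Fin n) → ℝ :=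
  fun y => ∑ i, ∑ j, invMetric G i j y * ricci G i j y

/-- The traceless Ricci tensor `z = Ric - (s / n) g`. -/
def tracelessRicci (G : Fin n → Fin n → EuclideanSpace ℝ (Fin n) → ℝ)
    (i j : Fin n) : EuclideanSpace ℝ (Fin n) → ℝ :=
  fun y => ricci G i j y - scalar G y / n * G i j y

/-- The Kulkarni–Nomizu product of two symmetric `2`-tensors. -/
def kulkarniNomizu (h q : Fin n → Fin n → EuclideanSpace ℝ (Fin n) → ℝ)
    (i j k l : Fin n) : EuclideanSpace ℝ (Fin n) → ℝ :=
  fun y => h i k y * q j l y + h j l y * q i k y - h i l y * q j k y - h j k y * q i l y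

/-- The Weyl tensor, from the decomposition
`R = W + s / (2 n (n - 1)) g ∧ g + 1 / (n - 2) z ∧ g` (Kulkarni–Nomizu products). -/
def weyl (G : Fin n → Fin n → EuclideanSpace ℝ (Fin n) → ℝ)
    (i j k l : Fin n) : EuclideanSpace ℝ (Fin n) → ℝ :=
  fun y => riemann G i j k l y
    - scalar G y / (2 * n * ((n : ℝ) - 1)) * kulkarniNomizu G G i j k l y
    - 1 / ((n : ℝ) - 2) * kulkarniNomizu (tracelessRicci G) G i j k l y

/-- The Hessian `Ddu(∂ᵢ, ∂ⱼ)` of a function. -/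
def hessian (G : Fin n → Fin n → EuclideanSpace ℝ (Fin n) → ℝ)
    (u : EuclideanSpace ℝ (Fin n) → ℝ) (i j : Fin n) : EuclideanSpace ℝ (Fin n) → ℝ :=
  fun y => partialD i (partialD j u) y - ∑ k, christoffel G k i j y * partialD k u y

/-- Covariant derivative `(D_{∂ₚ} A)(∂ᵢ, ∂ⱼ)` of a `2`-tensor. -/
def covDeriv2 (G : Fin n → Fin n → EuclideanSpace ℝ (Fin n) → ℝ)
    (A : Fin n → Fin n → EuclideanSpace ℝ (Fin n) → ℝ)
    (p i j : Fin n) : EuclideanSpace ℝ (Fin n) → ℝ :=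
  fun y => partialD p (A i j) y
    - ∑ q, (christoffel G q p i y * A q j y + christoffel G q p j y * A i q y)

/-- Covariant derivative `(D_{∂ₚ} A)(∂ᵢ, ∂ⱼ, ∂ₖ)` of a `3`-tensor. -/
def covDeriv3 (G : Fin n → Fin n → EuclideanSpace ℝ (Fin n) → ℝ)
    (A : Fin n → Fin n → Fin n → EuclideanSpace ℝ (Fin n) → ℝ)
    (p i j k : Fin n) : EuclideanSpace ℝ (Fin n) → ℝ :=
  fun y => partialD p (A i j k) y
    - ∑ q, (christoffel G q p i y * A q j k y + christoffel G q p j y * A i q k y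
      + christoffel G q p k y * A i j q y)

/-- Covariant derivative `(D_{∂ₚ} A)(∂ᵢ, ∂ⱼ, ∂ₖ, ∂ₗ)` of a `4`-tensor. -/
def covDeriv4 (G : Fin n → Fin n → EuclideanSpace ℝ (Fin n) → ℝ)
    (A : Fin n → Fin n → Fin n → Fin n → EuclideanSpace ℝ (Fin n) → ℝ)
    (p i j k l : Fin n) : EuclideanSpace ℝ (Fin n) → ℝ :=
  fun y => partialD p (A i j k l) y
    - ∑ q, (christoffel G q p i y * A q j k l y + christoffel G q p j y * A i q k l y
      + christoffel G q p k y * A i j q l y + christoffel G q p l y * A i j k q y)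

/-- The Cotton tensor `C = d^D (Ric - s / (2 (n - 1)) g)`, where
`d^D h (X, Y, Z) = D_X h (Y, Z) - D_Y h (X, Z)`. -/
def cotton (G : Fin n → Fin n → EuclideanSpace ℝ (Fin n) → ℝ)
    (i j k : Fin n) : EuclideanSpace ℝ (Fin n) → ℝ :=
  let h : Fin n → Fin n → EuclideanSpace ℝ (Fin n) → ℝ :=
    fun a b y => ricci G a b y - scalar G y / (2 * ((n : ℝ) - 1)) * G a b y
  fun y => covDeriv2 G h i j k y - covDeriv2 G h j i k y

/-- The (negative) divergence of the Weyl tensor,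
`δW(X, Y, Z) = - ∑ (D_{e_a} W)(e_a, X, Y, Z)` for an orthonormal frame `e_a`. -/
def deltaWeyl (G : Fin n → Fin n → EuclideanSpace ℝ (Fin n) → ℝ)
    (i j k : Fin n) : EuclideanSpace ℝ (Fin n) → ℝ :=
  fun y => - ∑ p, ∑ q, invMetric G p q y * covDeriv4 G (weyl G) p q i j k y

/-- `(δ^D A)(X, Y) = - ∑ (D_{e_a} A)(e_a, X, Y)` for a `3`-tensor `A` in `Λ² ⊗ T*`. -/
def deltaD (G : Fin n → Fin n → EuclideanSpace ℝ (Fin n) → ℝ)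
    (A : Fin n → Fin n → Fin n → EuclideanSpace ℝ (Fin n) → ℝ)
    (i j : Fin n) : EuclideanSpace ℝ (Fin n) → ℝ :=
  fun y => - ∑ p, ∑ q, invMetric G p q y * covDeriv3 G A p q i j y

/-- The action of the Weyl tensor on the traceless Ricci tensor,
`(W° z)(X, Y) = ∑ W(X, e_a, Y, e_b) z(e_a, e_b)` for an orthonormal frame. -/
def weylRing (G : Fin n → Fin n → EuclideanSpace ℝ (Fin n) → ℝ)
    (i j : Fin n) : EuclideanSpace ℝ (Fin n) → ℝ :=
  fun y => ∑ a, ∑ b, ∑ c, ∑ d, invMetric G a c y * invMetric G b d y *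
    weyl G i a j b y * tracelessRicci G c d y

/-- The Bach tensor `B = 1 / (n - 3) δ^D δ W + 1 / (n - 2) W° z`. Here `δW`, a section of
`T* ⊗ Λ²`, is read as a section of `Λ² ⊗ T*` by moving its first argument to the end. -/
def bach (G : Fin n → Fin n → EuclideanSpace ℝ (Fin n) → ℝ)
    (i j : Fin n) : EuclideanSpace ℝ (Fin n) → ℝ :=
  fun y => 1 / ((n : ℝ) - 3) * deltaD G (fun a b c => deltaWeyl G c a b) i j y
    + 1 / ((n : ℝ) - 2) * weylRing G i j y

/-- The `1`-form `i_{∇u} z (X) = z(∇u, X)`. -/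
def gradContractZ (G : Fin n → Fin n → EuclideanSpace ℝ (Fin n) → ℝ)
    (u : EuclideanSpace ℝ (Fin n) → ℝ) (i : Fin n) : EuclideanSpace ℝ (Fin n) → ℝ :=
  fun y => ∑ a, ∑ b, invMetric G a b y * partialD a u y * tracelessRicci G b i y

/-- For a `1`-form `η` and a symmetric `2`-tensor `h`:
`(η ∧ h)(X, Y, Z) = η(X) h(Y, Z) - η(Y) h(X, Z)`. -/
def wedge12 (η : Fin n → EuclideanSpace ℝ (Fin n) → ℝ)
    (h : Fin n → Fin n → EuclideanSpace ℝ (Fin n) → ℝ)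
    (i j k : Fin n) : EuclideanSpace ℝ (Fin n) → ℝ :=
  fun y => η i y * h j k y - η j y * h i k y

/-- The structure tensor
`T = 1 / (n - 2) du ∧ z + 1 / ((n - 1) (n - 2)) i_{∇u} z ∧ g`. -/
def structureT (G : Fin n → Fin n → EuclideanSpace ℝ (Fin n) → ℝ)
    (u : EuclideanSpace ℝ (Fin n) → ℝ) (i j k : Fin n) : EuclideanSpace ℝ (Fin n) → ℝ :=
  fun y => 1 / ((n : ℝ) - 2) * wedge12 (fun a => partialD a u) (tracelessRicci G) i j k y
    + 1 / (((n : ℝ) - 1) * ((n : ℝ) - 2)) * wedge12 (gradContractZ G u) G i j k y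

/-! ### Riemannian metrics on a smooth manifold -/

variable {M : Type*} [TopologicalSpace M] [ChartedSpace (EuclideanSpace ℝ (Fin n)) M]
  [IsManifold (𝓡 n) ∞ M]

variable (n M) in
/-- Smooth Riemannian metrics on the tangent bundle of an `n`-manifold `M`. -/
abbrev Metric : Type _ :=
  Bundle.ContMDiffRiemannianMetric (𝓡 n) ∞ (EuclideanSpace ℝ (Fin n))
    (fun x : M => TangentSpace (𝓡 n) x)

/-- The coordinate vector field `∂ᵢ` of the chart `e`, at the point with coordinates `y`. -/
def coordVec (e : OpenPartialHomeomorph M (EuclideanSpace ℝ (Fin n))) (i : Fin n)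
    (y : EuclideanSpace ℝ (Fin n)) : TangentSpace (𝓡 n) (e.symm y) :=
  mfderiv (𝓡 n) (𝓡 n) e.symm y
    (EuclideanSpace.single i (1 : ℝ) : EuclideanSpace ℝ (Fin n))

/-- Components `gᵢⱼ = g(∂ᵢ, ∂ⱼ)` of the metric in the chart `e`; they are meaningful on
`e.target`. -/
def metricComp (g : Metric n M) (e : OpenPartialHomeomorph M (EuclideanSpace ℝ (Fin n)))
    (i j : Fin n) : EuclideanSpace ℝ (Fin n) → ℝ :=
  fun y => g.inner (e.symm y) (coordVec e i y) (coordVec e j y)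

/-- `(M, g, f)` is a generalized `(λ, n + m)`-Einstein manifold: `f` and `λ` are smooth functions
and `Ddf = (f / m) (Ric - λ g)`, in all charts of the smooth structure. -/
structure IsGeneralizedEinstein (g : Metric n M) (f lam : M → ℝ) (m : ℝ) : Prop where
  m_pos : 0 < m
  smooth_f : ContMDiff (𝓡 n) 𝓘(ℝ, ℝ) ∞ f
  smooth_lam : ContMDiff (𝓡 n) 𝓘(ℝ, ℝ) ∞ lam
  equation : ∀ e ∈ IsManifold.maximalAtlas (𝓡 n) ∞ M, ∀ y ∈ e.target, ∀ i j : Fin n,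
    hessian (metricComp g e) (f ∘ e.symm) i j y
      = f (e.symm y) / m *
        (ricci (metricComp g e) i j y - lam (e.symm y) * metricComp g e i j y)

/-- The structure tensor `T` of `(M, g, f)` vanishes. -/
def StructureTensorVanishes (g : Metric n M) (f : M → ℝ) : Prop :=
  ∀ e ∈ IsManifold.maximalAtlas (𝓡 n) ∞ M, ∀ y ∈ e.target, ∀ i j k : Fin n,
    structureT (metricComp g e) (f ∘ e.symm) i j k y = 0

/-- The Cotton tensor of `g` vanishes. -/
def CottonVanishes (g : Metric n M) : Prop :=
  ∀ e ∈ IsManifold.maximalAtlas (𝓡 n) ∞ M, ∀ y ∈ e.target, ∀ i j k : Fin n,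
    cotton (metricComp g e) i j k y = 0

/-- `g` has harmonic Weyl curvature: `δW = 0`. -/
def HarmonicWeyl (g : Metric n M) : Prop :=
  ∀ e ∈ IsManifold.maximalAtlas (𝓡 n) ∞ M, ∀ y ∈ e.target, ∀ i j k : Fin n,
    deltaWeyl (metricComp g e) i j k y = 0

/-- `g` is Bach-flat (dimension at least `4`): `B = 0`. -/
def BachFlat (g : Metric n M) : Prop :=
  ∀ e ∈ IsManifold.maximalAtlas (𝓡 n) ∞ M, ∀ y ∈ e.target, ∀ i j : Fin n,
    bach (metricComp g e) i j y = 0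

end RiemChart

end

/-! Apart from one global step, the argument is pointwise tensor algebra in a chart. Contracting T =
0 with ∇f shows that where df ≠ 0 the traceless Ricci tensor is z = p df⊗df + q g with p, q smooth
(`tracelessRicci_eq`), so the Einstein equation becomes Ddf = b df⊗df + a g. Differentiating this,
the Ricci identity for Ddf writes -R(·,·,∇f,·) as α∧g + (db∧df)⊗df. This tensor vanishes when ∇f is
also put in the last slot, and its trace -Ric(∇f) is parallel to df; since n ≠ 2, these two facts
force db∧df = 0 (`wedge_eq_of_trace`). Hence R(·,·,∇f,·) = β∧g, and the same holds with β = 0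
wherever df = 0 (`curvature_gradient`).

The condition T = 0 also says that df∧z is a multiple of i_{∇f}z∧g. Put both facts into d^D of the
Einstein equation and into the decomposition of R: then f C and W(·,·,∇f,·) each have the form η∧g.
Both are trace-free on the relevant pair of slots (for C by ds = 2 div Ric), while η∧g has trace (n
- 1) η. So f C = 0 and W(·,·,∇f,·) = 0 (`mul_cotton_eq_zero`, `weyl_gradient`).

The global step allows f to be cancelled. The equation Ddf = f A is a linear system for the 1-jet of
f, so a zero 1-jet at a point spreads to a neighbourhood. By connectedness f vanishes on no nonempty
open set, and C = 0 follows by continuity. The divergence of W is a constant multiple of C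
(`deltaWeyl_eq_cotton`), so δW = 0. In the Bach tensor only W°z then remains. Where df ≠ 0, its part
from df⊗df dies by W(·,·,∇f,·) = 0 and its part from g because W is trace-free. On an open set where
df = 0 the Einstein equation gives f z = 0, which again lets f be cancelled (`weylRing_eq_zero`). -/

namespace RiemChart

open Filter Topology

/-! ### Rules for coordinate partial derivatives. -/

section PartialDerivatives

variable {n : ℕ} {U : Set (EuclideanSpace ℝ (Fin n))} {y : EuclideanSpace ℝ (Fin n)}
  {u v : EuclideanSpace ℝ (Fin n) → ℝ}

theorem differentiableAt_of_contDiffOn (hU : IsOpen U) (hu : ContDiffOn ℝ ∞ u U) (hy : y ∈ U) :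
    DifferentiableAt ℝ u y :=
  (hu.contDiffAt (hU.mem_nhds hy)).differentiableAt (by simp)

theorem contDiffOn_partialD (hU : IsOpen U) (hu : ContDiffOn ℝ ∞ u U) (i : Fin n) :
    ContDiffOn ℝ ∞ (partialD i u) U :=
  (hu.fderiv_of_isOpen hU (by simp)).clm_apply contDiffOn_const

theorem partialD_congr (hU : IsOpen U) (h : ∀ x ∈ U, u x = v x) (hy : y ∈ U) (i : Fin n) :
    partialD i u y = partialD i v y := by
  have : u =ᶠ[𝓝 y] v := Filter.eventuallyEq_of_mem (hU.mem_nhds hy) h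
  simp only [partialD, this.fderiv_eq]

theorem partialD_comm (hU : IsOpen U) (hu : ContDiffOn ℝ ∞ u U) (hy : y ∈ U) (i j : Fin n) :
    partialD i (partialD j u) y = partialD j (partialD i u) y := by
  have hd : DifferentiableAt ℝ (fderiv ℝ u) y :=
    ((hu.fderiv_of_isOpen (m := ∞) hU (by simp)).contDiffAt (hU.mem_nhds hy)).differentiableAt
      (by simp)
  have key : ∀ a b : Fin n, partialD a (partialD b u) y =
      fderiv ℝ (fderiv ℝ u) y (EuclideanSpace.single a 1) (EuclideanSpace.single b 1) := by
    intro a b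
    unfold partialD
    rw [fderiv_clm_apply hd (differentiableAt_const _)]
    simp
  rw [key, key]
  exact ((hu.contDiffAt (hU.mem_nhds hy)).isSymmSndFDerivAt (by simp; exact ENat.LEInfty.out)) _ _

theorem partialD_add (hu : DifferentiableAt ℝ u y) (hv : DifferentiableAt ℝ v y) (i : Fin n) :
    partialD i (fun x => u x + v x) y = partialD i u y + partialD i v y := by
  simp [partialD, fderiv_fun_add hu hv]

theorem partialD_sub (hu : DifferentiableAt ℝ u y) (hv : DifferentiableAt ℝ v y) (i : Fin n) :
    partialD i (fun x => u x - v x) y = partialD i u y - partialD i v y := by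
  simp [partialD, fderiv_fun_sub hu hv]

theorem partialD_mul (hu : DifferentiableAt ℝ u y) (hv : DifferentiableAt ℝ v y) (i : Fin n) :
    partialD i (fun x => u x * v x) y = partialD i u y * v y + u y * partialD i v y := by
  simp [partialD, fderiv_fun_mul hu hv]; ring

theorem partialD_const (c : ℝ) (i : Fin n) : partialD i (fun _ => c) y = 0 := by
  simp [partialD]

theorem partialD_const_mul (hu : DifferentiableAt ℝ u y) (c : ℝ) (i : Fin n) :
    partialD i (fun x => c * u x) y = c * partialD i u y := by
  simp [partialD, fderiv_const_mul hu c]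

theorem partialD_sum {ι : Type*} (s : Finset ι) {w : ι → EuclideanSpace ℝ (Fin n) → ℝ}
    (hw : ∀ a ∈ s, DifferentiableAt ℝ (w a) y) (i : Fin n) :
    partialD i (fun x => ∑ a ∈ s, w a x) y = ∑ a ∈ s, partialD i (w a) y := by
  simp [partialD, fderiv_fun_sum hw]

end PartialDerivatives

/-! ### Metrics in components, and smoothness of the tensors built from them. -/

section SmoothMetric

variable {n : ℕ} {G : Fin n → Fin n → EuclideanSpace ℝ (Fin n) → ℝ}
  {U : Set (EuclideanSpace ℝ (Fin n))} {y : EuclideanSpace ℝ (Fin n)}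

/-- `G` is a smooth Riemannian metric on the open set `U`, in components. -/
structure IsMetricOn (G : Fin n → Fin n → EuclideanSpace ℝ (Fin n) → ℝ)
    (U : Set (EuclideanSpace ℝ (Fin n))) : Prop where
  isOpen : IsOpen U
  smooth : ∀ i j, ContDiffOn ℝ ∞ (G i j) U
  posDef : ∀ y ∈ U, (Matrix.of fun i j => G i j y).PosDef

theorem contDiffOn_det {B : Fin n → Fin n → EuclideanSpace ℝ (Fin n) → ℝ}
    (hB : ∀ i j, ContDiffOn ℝ ∞ (B i j) U) :
    ContDiffOn ℝ ∞ (fun y => (Matrix.of fun i j => B i j y).det) U := by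
  simp only [Matrix.det_apply, Matrix.of_apply]
  refine ContDiffOn.sum fun σ _ => ContDiffOn.const_smul _ ?_
  exact contDiffOn_prod fun i _ => hB _ _

namespace IsMetricOn

theorem symm (h : IsMetricOn G U) (hy : y ∈ U) (i j : Fin n) : G i j y = G j i y := by
  have := (h.posDef y hy).isHermitian.apply j i
  simpa using this

theorem isUnit_det (h : IsMetricOn G U) (hy : y ∈ U) :
    IsUnit (Matrix.of fun i j => G i j y).det :=
  (h.posDef y hy).det_pos.ne'.isUnit

theorem inv_mul (h : IsMetricOn G U) (hy : y ∈ U) (i k : Fin n) :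
    ∑ j, invMetric G i j y * G j k y = if i = k then 1 else 0 := by
  have := congrFun (congrFun (Matrix.nonsing_inv_mul _ (h.isUnit_det hy)) i) k
  simpa [Matrix.mul_apply, Matrix.one_apply, invMetric] using this

theorem mul_inv (h : IsMetricOn G U) (hy : y ∈ U) (i k : Fin n) :
    ∑ j, G i j y * invMetric G j k y = if i = k then 1 else 0 := by
  have := congrFun (congrFun (Matrix.mul_nonsing_inv _ (h.isUnit_det hy)) i) k
  simpa [Matrix.mul_apply, Matrix.one_apply, invMetric] using this

theorem inv_symm (h : IsMetricOn G U) (hy : y ∈ U) (i j : Fin n) :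
    invMetric G i j y = invMetric G j i y := by
  have := (h.posDef y hy).inv.isHermitian.apply j i
  simpa [invMetric] using this

theorem inv_posDef (h : IsMetricOn G U) (hy : y ∈ U) :
    (Matrix.of fun i j => invMetric G i j y).PosDef := (h.posDef y hy).inv

/-- Cramer's rule: the entry is a quotient of determinants, the numerator being that of `G` with row
`j` replaced by the `i`-th unit vector. -/
theorem smooth_inv (h : IsMetricOn G U) (i j : Fin n) : ContDiffOn ℝ ∞ (invMetric G i j) U := by
  have h1 : ∀ y, invMetric G i j y = ((Matrix.of fun i j => G i j y).det)⁻¹ *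
      (Matrix.of fun a b => (if a = j then (if b = i then (1 : ℝ) else 0) else G a b y)).det := by
    intro y
    simp only [invMetric, Matrix.inv_def, Ring.inverse_eq_inv', Matrix.smul_apply, smul_eq_mul,
      Matrix.adjugate_apply]
    congr 2
    ext a b
    simp [Matrix.updateRow_apply, Pi.single_apply]
  rw [contDiffOn_congr (fun y _ => h1 y)]
  refine ContDiffOn.mul (ContDiffOn.inv (contDiffOn_det h.smooth)
    fun y hy => (h.isUnit_det hy).ne_zero) ?_
  refine contDiffOn_det
    (B := fun a b y => if a = j then (if b = i then (1 : ℝ) else 0) else G a b y) ?_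
  intro a b
  by_cases ha : a = j
  · simpa [ha] using contDiffOn_const
  · simpa [ha] using h.smooth a b

theorem smooth_christoffel (h : IsMetricOn G U) (k i j : Fin n) :
    ContDiffOn ℝ ∞ (christoffel G k i j) U := by
  unfold christoffel
  refine contDiffOn_const.mul (ContDiffOn.sum fun l _ => (h.smooth_inv _ _).mul ?_)
  exact ((contDiffOn_partialD h.isOpen (h.smooth _ _) _).add
    (contDiffOn_partialD h.isOpen (h.smooth _ _) _)).sub
    (contDiffOn_partialD h.isOpen (h.smooth _ _) _)

theorem smooth_curvEnd (h : IsMetricOn G U) (l i j k : Fin n) :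
    ContDiffOn ℝ ∞ (curvEnd G l i j k) U := by
  unfold curvEnd
  refine ((contDiffOn_partialD h.isOpen (h.smooth_christoffel _ _ _) _).sub
    (contDiffOn_partialD h.isOpen (h.smooth_christoffel _ _ _) _)).add
    (ContDiffOn.sum fun l _ => ?_)
  exact ((h.smooth_christoffel _ _ _).mul (h.smooth_christoffel _ _ _)).sub
    ((h.smooth_christoffel _ _ _).mul (h.smooth_christoffel _ _ _))

theorem smooth_riemann (h : IsMetricOn G U) (i j k l : Fin n) :
    ContDiffOn ℝ ∞ (riemann G i j k l) U :=
  ContDiffOn.sum fun _ _ => (h.smooth _ _).mul (h.smooth_curvEnd _ _ _ _)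

theorem smooth_ricci (h : IsMetricOn G U) (i j : Fin n) : ContDiffOn ℝ ∞ (ricci G i j) U :=
  ContDiffOn.sum fun _ _ => h.smooth_curvEnd _ _ _ _

theorem smooth_scalar (h : IsMetricOn G U) : ContDiffOn ℝ ∞ (scalar G) U :=
  ContDiffOn.sum fun _ _ => ContDiffOn.sum fun _ _ => (h.smooth_inv _ _).mul (h.smooth_ricci _ _)

theorem smooth_tracelessRicci (h : IsMetricOn G U) (i j : Fin n) :
    ContDiffOn ℝ ∞ (tracelessRicci G i j) U :=
  (h.smooth_ricci _ _).sub ((h.smooth_scalar.div_const _).mul (h.smooth _ _))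

theorem smooth_weyl (h : IsMetricOn G U) (i j k l : Fin n) :
    ContDiffOn ℝ ∞ (weyl G i j k l) U := by
  have hz := h.smooth_tracelessRicci
  have hg := h.smooth
  have hK : ∀ A : Fin n → Fin n → EuclideanSpace ℝ (Fin n) → ℝ,
      (∀ a b, ContDiffOn ℝ ∞ (A a b) U) → ContDiffOn ℝ ∞ (kulkarniNomizu A G i j k l) U :=
    fun A hA => ((((hA _ _).mul (hg _ _)).add ((hA _ _).mul (hg _ _))).sub
      ((hA _ _).mul (hg _ _))).sub ((hA _ _).mul (hg _ _))
  exact ((h.smooth_riemann _ _ _ _).sub ((h.smooth_scalar.div_const _).mul (hK _ hg))).sub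
    (contDiffOn_const.mul (hK _ hz))

theorem smooth_weylRing (h : IsMetricOn G U) (i j : Fin n) :
    ContDiffOn ℝ ∞ (weylRing G i j) U :=
  ContDiffOn.sum fun _ _ => ContDiffOn.sum fun _ _ => ContDiffOn.sum fun _ _ =>
    ContDiffOn.sum fun _ _ => (((h.smooth_inv _ _).mul (h.smooth_inv _ _)).mul
      (h.smooth_weyl _ _ _ _)).mul (h.smooth_tracelessRicci _ _)

theorem smooth_covDeriv2 (h : IsMetricOn G U)
    {A : Fin n → Fin n → EuclideanSpace ℝ (Fin n) → ℝ}
    (hA : ∀ a b, ContDiffOn ℝ ∞ (A a b) U) (p i j : Fin n) :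
    ContDiffOn ℝ ∞ (covDeriv2 G A p i j) U :=
  (contDiffOn_partialD h.isOpen (hA _ _) _).sub (ContDiffOn.sum fun _ _ =>
    ((h.smooth_christoffel _ _ _).mul (hA _ _)).add ((h.smooth_christoffel _ _ _).mul (hA _ _)))

theorem smooth_cotton (h : IsMetricOn G U) (i j k : Fin n) :
    ContDiffOn ℝ ∞ (cotton G i j k) U := by
  have hA : ∀ a b, ContDiffOn ℝ ∞
      (fun y => ricci G a b y - scalar G y / (2 * ((n : ℝ) - 1)) * G a b y) U :=
    fun a b => (h.smooth_ricci _ _).sub ((h.smooth_scalar.div_const _).mul (h.smooth _ _))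
  exact (h.smooth_covDeriv2 hA i j k).sub (h.smooth_covDeriv2 hA j i k)

end IsMetricOn

end SmoothMetric

/-! ### The Levi-Civita connection and the symmetries of the curvature tensor. -/

section LeviCivita

variable {n : ℕ} {G : Fin n → Fin n → EuclideanSpace ℝ (Fin n) → ℝ}
  {U : Set (EuclideanSpace ℝ (Fin n))} {y : EuclideanSpace ℝ (Fin n)}

theorem covDeriv2_congr (hU : IsOpen U) {A B : Fin n → Fin n → EuclideanSpace ℝ (Fin n) → ℝ}
    (hAB : ∀ x ∈ U, ∀ i j, A i j x = B i j x) (hy : y ∈ U) (p i j : Fin n) :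
    covDeriv2 G A p i j y = covDeriv2 G B p i j y := by
  simp only [covDeriv2, hAB y hy, partialD_congr hU (fun x hx => hAB x hx i j) hy]

theorem covDeriv4_congr (hU : IsOpen U)
    {A B : Fin n → Fin n → Fin n → Fin n → EuclideanSpace ℝ (Fin n) → ℝ}
    (hAB : ∀ x ∈ U, ∀ i j k l, A i j k l x = B i j k l x) (hy : y ∈ U) (p i j k l : Fin n) :
    covDeriv4 G A p i j k l y = covDeriv4 G B p i j k l y := by
  simp only [covDeriv4, hAB y hy, partialD_congr hU (fun x hx => hAB x hx i j k l) hy]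

namespace IsMetricOn

/-- Lowering an index after raising it with the metric. -/
theorem sum_lower_raise (h : IsMetricOn G U) (hy : y ∈ U) (X : Fin n → ℝ) (k : Fin n) :
    ∑ i, G i k y * ∑ j, invMetric G i j y * X j = X k := by
  simp only [Finset.mul_sum]
  rw [Finset.sum_comm]
  have : ∀ j, ∑ i, G i k y * (invMetric G i j y * X j) = (if k = j then 1 else 0) * X j := by
    intro j
    rw [← h.mul_inv hy k j, Finset.sum_mul]
    exact Finset.sum_congr rfl fun i _ => by rw [h.symm hy k i]; ring
  simp [this]

/-- Raising an index after lowering it with the metric. -/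
theorem sum_raise_lower (h : IsMetricOn G U) (hy : y ∈ U) (X : Fin n → ℝ) (k : Fin n) :
    ∑ i, invMetric G k i y * ∑ j, G i j y * X j = X k := by
  simp only [Finset.mul_sum]
  rw [Finset.sum_comm]
  have : ∀ j, ∑ i, invMetric G k i y * (G i j y * X j) = (if k = j then 1 else 0) * X j := by
    intro j
    rw [← h.inv_mul hy k j, Finset.sum_mul]
    exact Finset.sum_congr rfl fun i _ => by ring
  simp [this]

theorem diff (h : IsMetricOn G U) (hy : y ∈ U) (i j : Fin n) : DifferentiableAt ℝ (G i j) y :=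
  differentiableAt_of_contDiffOn h.isOpen (h.smooth i j) hy

theorem diff_christoffel (h : IsMetricOn G U) (hy : y ∈ U) (k i j : Fin n) :
    DifferentiableAt ℝ (christoffel G k i j) y :=
  differentiableAt_of_contDiffOn h.isOpen (h.smooth_christoffel k i j) hy

theorem diff_partialD_christoffel (h : IsMetricOn G U) (hy : y ∈ U) (p k i j : Fin n) :
    DifferentiableAt ℝ (partialD p (christoffel G k i j)) y :=
  differentiableAt_of_contDiffOn h.isOpen
    (contDiffOn_partialD h.isOpen (h.smooth_christoffel k i j) p) hy

theorem partialD_symm (h : IsMetricOn G U) (hy : y ∈ U) (p i j : Fin n) :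
    partialD p (G i j) y = partialD p (G j i) y :=
  partialD_congr h.isOpen (fun _ hx => h.symm hx i j) hy p

theorem christoffel_symm (h : IsMetricOn G U) (hy : y ∈ U) (k i j : Fin n) :
    christoffel G k i j y = christoffel G k j i y := by
  unfold christoffel
  congr 1
  refine Finset.sum_congr rfl fun l _ => ?_
  rw [h.partialD_symm hy l i j]
  ring

theorem christoffel_lower (h : IsMetricOn G U) (hy : y ∈ U) (m i j : Fin n) :
    ∑ k, christoffel G k i j y * G k m y =
      (1 / 2) * (partialD i (G j m) y + partialD j (G i m) y - partialD m (G i j) y) := by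
  have := h.sum_lower_raise hy
    (fun l => (partialD i (G j l) y + partialD j (G i l) y - partialD l (G i j) y)) m
  rw [← this, Finset.mul_sum]
  refine Finset.sum_congr rfl fun k _ => ?_
  unfold christoffel
  ring

/-- The Levi-Civita connection is compatible with the metric. -/
theorem partialD_metric (h : IsMetricOn G U) (hy : y ∈ U) (p i j : Fin n) :
    partialD p (G i j) y =
      ∑ q, (christoffel G q p i y * G q j y + christoffel G q p j y * G i q y) := by
  rw [Finset.sum_add_distrib, h.christoffel_lower hy j p i,
    Finset.sum_congr rfl (fun q _ => by rw [h.symm hy i q] :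
      ∀ q ∈ Finset.univ, christoffel G q p j y * G i q y = christoffel G q p j y * G q i y),
    h.christoffel_lower hy i p j, h.partialD_symm hy p j i]
  ring

theorem covDeriv2_metric (h : IsMetricOn G U) (hy : y ∈ U) (p i j : Fin n) :
    covDeriv2 G G p i j y = 0 := by
  rw [covDeriv2, h.partialD_metric hy, sub_self]

/-- The matrix of the connection form `Γₚ`, with entries `Γ^q_{pi}`. -/
noncomputable def connMat (G : Fin n → Fin n → EuclideanSpace ℝ (Fin n) → ℝ) (p : Fin n)
    (y : EuclideanSpace ℝ (Fin n)) : Matrix (Fin n) (Fin n) ℝ :=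
  Matrix.of fun q i => christoffel G q p i y

/-- The matrix of the derivative `∂ₛ Γₚ` of the connection form. -/
noncomputable def dConnMat (G : Fin n → Fin n → EuclideanSpace ℝ (Fin n) → ℝ) (s p : Fin n)
    (y : EuclideanSpace ℝ (Fin n)) : Matrix (Fin n) (Fin n) ℝ :=
  Matrix.of fun q i => partialD s (christoffel G q p i) y

/-- The matrix of the second derivative `∂ₜ ∂ₛ Γₚ` of the connection form. -/
noncomputable def ddConnMat (G : Fin n → Fin n → EuclideanSpace ℝ (Fin n) → ℝ) (t s p : Fin n)
    (y : EuclideanSpace ℝ (Fin n)) : Matrix (Fin n) (Fin n) ℝ :=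
  Matrix.of fun q i => partialD t (partialD s (christoffel G q p i)) y

/-- The matrix of the curvature endomorphism `R(∂ᵢ, ∂ⱼ)`. -/
noncomputable def curvMat (G : Fin n → Fin n → EuclideanSpace ℝ (Fin n) → ℝ) (i j : Fin n)
    (y : EuclideanSpace ℝ (Fin n)) : Matrix (Fin n) (Fin n) ℝ :=
  Matrix.of fun l k => curvEnd G l i j k y

/-- In the matrix form ∂Γ - ∂Γ + [Γ, Γ], the curvature identities become identities in a
noncommutative ring rather than manipulations of index sums. -/
theorem curvMat_eq (i j : Fin n) : curvMat G i j y = dConnMat G i j y - dConnMat G j i y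
    + (connMat G i y * connMat G j y - connMat G j y * connMat G i y) := by
  ext l k
  simp [curvMat, dConnMat, connMat, curvEnd, Matrix.mul_apply, Finset.sum_sub_distrib]

/-- The inverse metric is parallel as well: differentiate g⁻¹ g = 1, insert ∂g = Γᵗ g + g Γ, and
solve for ∂g⁻¹. -/
theorem partialD_inv (h : IsMetricOn G U) (hy : y ∈ U) (p i j : Fin n) :
    partialD p (invMetric G i j) y =
      - ∑ q, (christoffel G i p q y * invMetric G q j y
        + christoffel G j p q y * invMetric G i q y) := by
  set g : Matrix (Fin n) (Fin n) ℝ := Matrix.of fun a b => G a b y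
  set gi : Matrix (Fin n) (Fin n) ℝ := Matrix.of fun a b => invMetric G a b y
  set dgi : Matrix (Fin n) (Fin n) ℝ := Matrix.of fun a b => partialD p (invMetric G a b) y
  set dg : Matrix (Fin n) (Fin n) ℝ := Matrix.of fun a b => partialD p (G a b) y
  have h1 : g * gi = 1 := by
    ext a b
    simpa [g, gi, Matrix.mul_apply, Matrix.one_apply] using h.mul_inv hy a b
  have h2 : dg = (connMat G p y).transpose * g + g * connMat G p y := by
    ext a b
    simp only [dg, Matrix.of_apply, h.partialD_metric hy, Matrix.add_apply, Matrix.mul_apply,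
      Matrix.transpose_apply, connMat, g, ← Finset.sum_add_distrib]
    exact Finset.sum_congr rfl fun q _ => by ring
  have h3 : dgi * g + gi * dg = 0 := by
    ext a b
    have e1 : partialD p (fun x => ∑ c, invMetric G a c x * G c b x) y = 0 := by
      rw [partialD_congr h.isOpen (fun x hx => h.inv_mul hx a b) hy, partialD_const]
    have hdi : ∀ c d, DifferentiableAt ℝ (invMetric G c d) y := fun c d =>
      differentiableAt_of_contDiffOn h.isOpen (h.smooth_inv c d) hy
    rw [partialD_sum _ fun c _ => (hdi a c).fun_mul (h.diff hy c b)] at e1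
    simp only [partialD_mul (hdi _ _) (h.diff hy _ _), Finset.sum_add_distrib] at e1
    simpa [Matrix.mul_apply, dgi, dg, g, gi] using e1
  have h1' : gi * g = 1 := mul_eq_one_comm.mp h1
  have h4 : dgi = - (gi * (connMat G p y).transpose + connMat G p y * gi) := by
    have : dgi = (dgi * g + gi * dg) * gi - gi * dg * gi := by
      rw [add_mul, mul_assoc, h1]; simp
    rw [this, h3, h2]
    simp only [mul_add, add_mul, zero_mul, zero_sub]
    rw [mul_assoc gi (_ * g), mul_assoc _ g, h1, ← mul_assoc gi g, h1', mul_one, one_mul]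
  have h5 := congrFun (congrFun h4 i) j
  simp only [dgi, Matrix.of_apply, Matrix.neg_apply, Matrix.add_apply, Matrix.mul_apply,
    Matrix.transpose_apply, connMat, gi, ← Finset.sum_add_distrib] at h5
  rw [h5]
  congr 1
  exact Finset.sum_congr rfl fun q _ => by ring

theorem curvEnd_antisymm (l i j k : Fin n) : curvEnd G l i j k y = - curvEnd G l j i k y := by
  simp only [curvEnd, Finset.sum_sub_distrib]
  ring

theorem riemann_antisymm_left (i j k l : Fin n) : riemann G i j k l y = - riemann G j i k l y := by
  simp only [riemann, ← Finset.sum_neg_distrib]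
  exact Finset.sum_congr rfl fun p _ => by rw [curvEnd_antisymm p i j l]; ring

/-- The first Bianchi identity. -/
theorem curvEnd_cyclic (h : IsMetricOn G U) (hy : y ∈ U) (l i j k : Fin n) :
    curvEnd G l i j k y + curvEnd G l j k i y + curvEnd G l k i j y = 0 := by
  have hd : ∀ p a b, partialD p (christoffel G l a b) y = partialD p (christoffel G l b a) y :=
    fun p a b => partialD_congr h.isOpen (fun _ hx => h.christoffel_symm hx l a b) hy p
  simp only [curvEnd, Finset.sum_sub_distrib]
  rw [hd i k j, hd j i k, hd k j i]
  have e : ∀ a b c, ∑ p, christoffel G l a p y * christoffel G p b c y =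
      ∑ p, christoffel G l a p y * christoffel G p c b y := fun a b c =>
    Finset.sum_congr rfl fun p _ => by rw [h.christoffel_symm hy p b c]
  rw [e i k j, e j i k, e k j i]
  ring

/-- Mixed second partial derivatives of the metric commute. Expressing them through Γ by metric
compatibility, their commutator is the symmetric part of the curvature with lowered index, which is
therefore zero. -/
theorem riemann_antisymm_right (h : IsMetricOn G U) (hy : y ∈ U) (i j k l : Fin n) :
    riemann G i j k l y = - riemann G i j l k y := by
  set g : Matrix (Fin n) (Fin n) ℝ := Matrix.of fun a b => G a b y
  -- Obtained by differentiating ∂ₚg = Γₚᵗ g + g Γₚ once more.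
  have hdd : ∀ s p a b, partialD s (partialD p (G a b)) y =
      ((dConnMat G s p y).transpose * g + (connMat G p y).transpose *
        ((connMat G s y).transpose * g + g * connMat G s y) +
      ((connMat G s y).transpose * g + g * connMat G s y) * connMat G p y
        + g * dConnMat G s p y) a b := by
    intro s p a b
    have hdg : Matrix.of (fun a b => partialD s (G a b) y) =
        (connMat G s y).transpose * g + g * connMat G s y := by
      ext a b
      simp only [Matrix.of_apply, h.partialD_metric hy, Matrix.add_apply, Matrix.mul_apply,
        Matrix.transpose_apply, connMat, g, ← Finset.sum_add_distrib]
      exact Finset.sum_congr rfl fun q _ => by ring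
    rw [← hdg, partialD_congr h.isOpen (fun x hx => h.partialD_metric hx p a b) hy,
      partialD_sum _ fun q _ => ((h.diff_christoffel hy q p a).fun_mul (h.diff hy q b)).fun_add
        ((h.diff_christoffel hy q p b).fun_mul (h.diff hy a q))]
    simp only [Matrix.add_apply, Matrix.mul_apply, Matrix.transpose_apply, connMat, dConnMat, g,
      Matrix.of_apply, ← Finset.sum_add_distrib]
    refine Finset.sum_congr rfl fun q _ => ?_
    rw [partialD_add ((h.diff_christoffel hy q p a).fun_mul (h.diff hy q b))
        ((h.diff_christoffel hy q p b).fun_mul (h.diff hy a q)),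
      partialD_mul (h.diff_christoffel hy q p a) (h.diff hy q b),
      partialD_mul (h.diff_christoffel hy q p b) (h.diff hy a q)]
    ring
  have hgt : g.transpose = g := by
    ext a b; exact h.symm hy b a
  have key : g * curvMat G i j y + (g * curvMat G i j y).transpose = 0 := by
    have e : ∀ a b, partialD i (partialD j (G a b)) y - partialD j (partialD i (G a b)) y = 0 :=
      fun a b => sub_eq_zero.mpr (partialD_comm h.isOpen (h.smooth a b) hy i j)
    have e2 : g * curvMat G i j y + (g * curvMat G i j y).transpose =
        Matrix.of (fun a b => partialD i (partialD j (G a b)) y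
          - partialD j (partialD i (G a b)) y) := by
      have : Matrix.of (fun a b => partialD i (partialD j (G a b)) y
          - partialD j (partialD i (G a b)) y) = _ - _ :=
        Matrix.ext fun a b => by
          rw [Matrix.of_apply, hdd, hdd, ← Matrix.sub_apply]
      rw [this, curvMat_eq]
      simp only [Matrix.transpose_mul, Matrix.transpose_add, Matrix.transpose_sub, hgt]
      noncomm_ring
    rw [e2]
    ext a b
    exact e a b
  have := congrFun (congrFun key k) l
  simp only [Matrix.add_apply, Matrix.transpose_apply, Matrix.mul_apply, curvMat, g,
    Matrix.of_apply, Matrix.zero_apply] at this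
  simp only [riemann]
  linarith

/-- In the convention R(X, Y, Z, V) = g(R(X, Y)V, Z) the vector acted upon sits in the last slot, so
the first Bianchi identity cycles slots 1, 2 and 4. -/
theorem riemann_cyclic (h : IsMetricOn G U) (hy : y ∈ U) (i j k l : Fin n) :
    riemann G i j l k y + riemann G j k l i y + riemann G k i l j y = 0 := by
  simp only [riemann, ← Finset.sum_add_distrib]
  refine Finset.sum_eq_zero fun p _ => ?_
  have := h.curvEnd_cyclic hy p i j k
  linear_combination G l p y * this

/-- The classical octahedron argument: four instances of the first Bianchi identity are combined,
and the two antisymmetries identify all terms but the wanted pair. -/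
theorem riemann_pair_symm (h : IsMetricOn G U) (hy : y ∈ U) (i j k l : Fin n) :
    riemann G i j k l y = riemann G k l i j y := by
  have c := h.riemann_cyclic hy
  have a : ∀ i j k l, riemann G i j k l y = - riemann G j i k l y := riemann_antisymm_left
  have b := h.riemann_antisymm_right hy
  have c1 := c i j k l
  have c2 := c j k l i
  have c3 := c k l i j
  have c4 := c l i j k
  linarith [a i j k l, a j k l i, a k i l j, a k l i j, a l i j k, a j l i k, b i j k l, b j k l i,
    b k i l j, b k l i j, b l i j k, b j l i k, a i k j l, b i k l j, a l j k i, b l j i k,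
    a j i l k, a i j l k, b j i l k, b k l j i, a k l j i, a k j i l, b k j i l, b j k i l,
    a l j i k, b k i j l, b j l k i, a j l k i, b i k j l, a i l k j, b l i k j, a l i k j, b i l k j]

theorem sum_inv_riemann (h : IsMetricOn G U) (hy : y ∈ U) (r i j l : Fin n) :
    ∑ k, invMetric G r k y * riemann G i j k l y = curvEnd G r i j l y :=
  h.sum_raise_lower hy (fun p => curvEnd G p i j l y) r

theorem ricci_eq (h : IsMetricOn G U) (hy : y ∈ U) (j k : Fin n) :
    ricci G j k y = ∑ i, ∑ p, invMetric G i p y * riemann G i j p k y :=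
  Finset.sum_congr rfl fun i _ => (h.sum_inv_riemann hy i i j k).symm

theorem ricci_symm (h : IsMetricOn G U) (hy : y ∈ U) (j k : Fin n) :
    ricci G j k y = ricci G k j y := by
  rw [h.ricci_eq hy, h.ricci_eq hy, Finset.sum_comm]
  refine Finset.sum_congr rfl fun i _ => Finset.sum_congr rfl fun p _ => ?_
  rw [h.inv_symm hy, h.riemann_pair_symm hy]

end IsMetricOn

end LeviCivita

/-! ### The second Bianchi identity, its contractions, and the Ricci identity. -/

section Bianchi

variable {n : ℕ} {G : Fin n → Fin n → EuclideanSpace ℝ (Fin n) → ℝ}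
  {U : Set (EuclideanSpace ℝ (Fin n))} {y : EuclideanSpace ℝ (Fin n)}

/-- Covariant derivative `(D_{∂ₚ} R)ˡᵢⱼₖ` of the curvature endomorphism. -/
noncomputable def covCurv (G : Fin n → Fin n → EuclideanSpace ℝ (Fin n) → ℝ)
    (p l i j k : Fin n) (y : EuclideanSpace ℝ (Fin n)) : ℝ :=
  partialD p (curvEnd G l i j k) y
    + ∑ q, (christoffel G l p q y * curvEnd G q i j k y
      - christoffel G q p i y * curvEnd G l q j k y
      - christoffel G q p j y * curvEnd G l i q k y
      - christoffel G q p k y * curvEnd G l i j q y)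

namespace IsMetricOn

theorem diff_curvEnd (h : IsMetricOn G U) (hy : y ∈ U) (l i j k : Fin n) :
    DifferentiableAt ℝ (curvEnd G l i j k) y :=
  differentiableAt_of_contDiffOn h.isOpen (h.smooth_curvEnd l i j k) hy

theorem partialD_curvEnd (h : IsMetricOn G U) (hy : y ∈ U) (p l i j k : Fin n) :
    partialD p (curvEnd G l i j k) y =
      (ddConnMat G p i j y - ddConnMat G p j i y
        + (dConnMat G p i y * connMat G j y + connMat G i y * dConnMat G p j y
          - dConnMat G p j y * connMat G i y - connMat G j y * dConnMat G p i y)) l k := by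
  have hd := h.diff_partialD_christoffel hy
  have hc := h.diff_christoffel hy
  have hm : ∀ q, DifferentiableAt ℝ (fun y => christoffel G l i q y * christoffel G q j k y
      - christoffel G l j q y * christoffel G q i k y) y := fun q =>
    ((hc l i q).fun_mul (hc q j k)).fun_sub ((hc l j q).fun_mul (hc q i k))
  unfold curvEnd
  rw [partialD_add ((hd _ _ _ _).fun_sub (hd _ _ _ _)) (DifferentiableAt.fun_sum fun q _ => hm q),
    partialD_sub (hd _ _ _ _) (hd _ _ _ _), partialD_sum _ fun q _ => hm q]
  simp only [Matrix.add_apply, Matrix.sub_apply, Matrix.mul_apply, ddConnMat, dConnMat, connMat,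
    Matrix.of_apply, ← Finset.sum_add_distrib, ← Finset.sum_sub_distrib]
  congr 1
  refine Finset.sum_congr rfl fun q _ => ?_
  rw [partialD_sub ((hc l i q).fun_mul (hc q j k)) ((hc l j q).fun_mul (hc q i k)),
    partialD_mul (hc _ _ _) (hc _ _ _), partialD_mul (hc _ _ _) (hc _ _ _)]
  ring

theorem ddConnMat_comm (h : IsMetricOn G U) (hy : y ∈ U) (s t p : Fin n) :
    ddConnMat G s t p y = ddConnMat G t s p y := by
  ext a b
  exact partialD_comm h.isOpen (h.smooth_christoffel a p b) hy s t

/-- The second Bianchi identity. -/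
theorem covCurv_cyclic (h : IsMetricOn G U) (hy : y ∈ U) (p l i j k : Fin n) :
    covCurv G p l i j k y + covCurv G i l j p k y + covCurv G j l p i k y = 0 := by
  -- As matrices, DₚRᵢⱼ is ∂ₚRᵢⱼ + [Γₚ, Rᵢⱼ] plus Christoffel corrections in the indices i and j.
  -- These corrections cancel in the cyclic sum because Γ is symmetric, which leaves the Bianchi
  -- identity for the matrix-valued 2-form.
  have key : ∀ p i j, covCurv G p l i j k y =
      (ddConnMat G p i j y - ddConnMat G p j i y
        + (dConnMat G p i y * connMat G j y + connMat G i y * dConnMat G p j y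
          - dConnMat G p j y * connMat G i y - connMat G j y * dConnMat G p i y)
        + connMat G p y * curvMat G i j y - curvMat G i j y * connMat G p y) l k
      + (∑ q, christoffel G q p j y * curvEnd G l q i k y
        - ∑ q, christoffel G q p i y * curvEnd G l q j k y) := by
    intro p i j
    have hX : ∀ X : Matrix (Fin n) (Fin n) ℝ,
        (X + connMat G p y * curvMat G i j y - curvMat G i j y * connMat G p y) l k =
        X l k + ∑ q, christoffel G l p q y * curvEnd G q i j k y
          - ∑ q, curvEnd G l i j q y * christoffel G q p k y := by
      intro X
      simp [Matrix.mul_apply, connMat, curvMat]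
    rw [covCurv, h.partialD_curvEnd hy, hX]
    simp only [Finset.sum_sub_distrib]
    rw [Finset.sum_congr rfl (fun q _ => by rw [curvEnd_antisymm l i q k, mul_neg] :
      ∀ q ∈ Finset.univ, christoffel G q p j y * curvEnd G l i q k y =
        -(christoffel G q p j y * curvEnd G l q i k y)), Finset.sum_neg_distrib,
      Finset.sum_congr rfl (fun q _ => mul_comm _ _ : ∀ q ∈ Finset.univ,
        christoffel G q p k y * curvEnd G l i j q y = _)]
    ring
  have hsym : ∀ a b c, ∑ q, christoffel G q a b y * curvEnd G l q c k y =
      ∑ q, christoffel G q b a y * curvEnd G l q c k y := fun a b c =>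
    Finset.sum_congr rfl fun q _ => by rw [h.christoffel_symm hy q a b]
  rw [key, key, key, hsym p j i, hsym i p j, hsym j i p]
  have hz : ∀ A B C : Matrix (Fin n) (Fin n) ℝ, A + B + C = 0 → A l k + B l k + C l k = 0 := by
    intro A B C hABC
    simpa using congrFun (congrFun hABC l) k
  have := hz _ _ _ (show
    (ddConnMat G p i j y - ddConnMat G p j i y
        + (dConnMat G p i y * connMat G j y + connMat G i y * dConnMat G p j y
          - dConnMat G p j y * connMat G i y - connMat G j y * dConnMat G p i y)
        + connMat G p y * curvMat G i j y - curvMat G i j y * connMat G p y)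
    + (ddConnMat G i j p y - ddConnMat G i p j y
        + (dConnMat G i j y * connMat G p y + connMat G j y * dConnMat G i p y
          - dConnMat G i p y * connMat G j y - connMat G p y * dConnMat G i j y)
        + connMat G i y * curvMat G j p y - curvMat G j p y * connMat G i y)
    + (ddConnMat G j p i y - ddConnMat G j i p y
        + (dConnMat G j p y * connMat G i y + connMat G p y * dConnMat G j i y
          - dConnMat G j i y * connMat G p y - connMat G i y * dConnMat G j p y)
        + connMat G j y * curvMat G p i y - curvMat G p i y * connMat G j y) = 0 by
      rw [h.ddConnMat_comm hy j i p, h.ddConnMat_comm hy p i j, h.ddConnMat_comm hy p j i]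
      simp only [curvMat_eq]
      noncomm_ring)
  linear_combination this

theorem covCurv_antisymm (h : IsMetricOn G U) (hy : y ∈ U) (p l i j k : Fin n) :
    covCurv G p l i j k y = - covCurv G p l j i k y := by
  have e : partialD p (curvEnd G l i j k) y = - partialD p (curvEnd G l j i k) y := by
    rw [partialD_congr h.isOpen (v := fun x => (-1) * curvEnd G l j i k x)
      (fun x _ => by rw [curvEnd_antisymm]; ring) hy,
      partialD_const_mul (h.diff_curvEnd hy _ _ _ _)]
    ring
  simp only [covCurv, e, neg_add, ← Finset.sum_neg_distrib]
  congr 1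
  refine Finset.sum_congr rfl fun q _ => ?_
  rw [curvEnd_antisymm q i j k, curvEnd_antisymm l q j k, curvEnd_antisymm l i q k,
    curvEnd_antisymm l i j q]
  ring

/-- Contraction commutes with D: the Christoffel corrections of the contracted upper and lower
indices cancel. -/
theorem sum_covCurv (h : IsMetricOn G U) (hy : y ∈ U) (p j k : Fin n) :
    ∑ l, covCurv G p l l j k y = covDeriv2 G (ricci G) p j k y := by
  have e1 : partialD p (ricci G j k) y = ∑ l, partialD p (curvEnd G l l j k) y := by
    unfold ricci
    exact partialD_sum _ (fun l _ => h.diff_curvEnd hy l l j k) p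
  have e2 : ∑ l, ∑ q, christoffel G l p q y * curvEnd G q l j k y =
      ∑ l, ∑ q, christoffel G q p l y * curvEnd G l q j k y := Finset.sum_comm
  simp only [covCurv, covDeriv2, e1, Finset.sum_add_distrib, Finset.sum_sub_distrib, e2]
  simp only [ricci, Finset.mul_sum]
  rw [Finset.sum_comm (f := fun l q => christoffel G q p j y * curvEnd G l l q k y),
    Finset.sum_comm (f := fun l q => christoffel G q p k y * curvEnd G l l j q y)]
  ring

/-- The contracted second Bianchi identity. -/
theorem sum_covCurv_div (h : IsMetricOn G U) (hy : y ∈ U) (i j k : Fin n) :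
    ∑ l, covCurv G l l i j k y =
      covDeriv2 G (ricci G) i j k y - covDeriv2 G (ricci G) j i k y := by
  have := Finset.sum_eq_zero fun l (_ : l ∈ Finset.univ) => h.covCurv_cyclic hy l l i j k
  simp only [Finset.sum_add_distrib] at this
  rw [Finset.sum_congr rfl fun l _ => h.covCurv_antisymm hy i l j l k, Finset.sum_neg_distrib,
    h.sum_covCurv hy, h.sum_covCurv hy] at this
  linarith

/-- Lowering an index commutes with D since Dg = 0. Of the two Christoffel terms in ∂g, one cancels
the correction in slot `k` and the other is the upper-index correction in `covCurv`. -/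
theorem covDeriv4_riemann (h : IsMetricOn G U) (hy : y ∈ U) (p i j k l : Fin n) :
    covDeriv4 G (riemann G) p i j k l y = ∑ r, G k r y * covCurv G p r i j l y := by
  have e1 : partialD p (riemann G i j k l) y = ∑ r, (partialD p (G k r) y * curvEnd G r i j l y
      + G k r y * partialD p (curvEnd G r i j l) y) := by
    unfold riemann
    rw [partialD_sum _ fun r _ => (h.diff hy k r).fun_mul (h.diff_curvEnd hy r i j l)]
    exact Finset.sum_congr rfl fun r _ => partialD_mul (h.diff hy k r) (h.diff_curvEnd hy r i j l) p
  have e2 : ∑ r, ∑ q, christoffel G q p r y * G k q y * curvEnd G r i j l y =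
      ∑ r, ∑ q, G k r y * (christoffel G r p q y * curvEnd G q i j l y) := by
    rw [Finset.sum_comm]
    exact Finset.sum_congr rfl fun r _ => Finset.sum_congr rfl fun q _ => by ring
  have e3 : ∀ X : Fin n → Fin n → ℝ, ∑ q, ∑ r, X q r = ∑ r, ∑ q, X q r :=
    fun X => Finset.sum_comm
  simp only [covDeriv4, covCurv, e1, h.partialD_metric hy, Finset.sum_add_distrib, mul_add,
    Finset.sum_sub_distrib, mul_sub, Finset.sum_mul, Finset.mul_sum, add_mul, e2, riemann]
  rw [e3 fun q r => christoffel G q p i y * (G k r y * curvEnd G r q j l y),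
    e3 fun q r => christoffel G q p j y * (G k r y * curvEnd G r i q l y),
    e3 fun q r => christoffel G q p k y * (G q r y * curvEnd G r i j l y),
    e3 fun q r => christoffel G q p l y * (G k r y * curvEnd G r i j q y)]
  simp only [← mul_assoc, mul_comm (G k _ y)]
  ring

/-- The divergence of the Riemann tensor on its first index. -/
theorem div_riemann (h : IsMetricOn G U) (hy : y ∈ U) (i j k : Fin n) :
    ∑ p, ∑ q, invMetric G p q y * covDeriv4 G (riemann G) p q i j k y =
      covDeriv2 G (ricci G) j k i y - covDeriv2 G (ricci G) k j i y := by
  rw [← h.sum_covCurv_div hy]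
  refine Finset.sum_congr rfl fun p _ => ?_
  rw [← h.sum_raise_lower hy (fun r => covCurv G p r j k i y) p]
  refine Finset.sum_congr rfl fun q _ => ?_
  -- Pair symmetry carries the contracted first slot to the third, the one lowered in `riemann`;
  -- raising it turns the divergence into the trace of `covCurv`.
  rw [← h.covDeriv4_riemann hy, covDeriv4, covDeriv4,
    partialD_congr h.isOpen (fun x hx => h.riemann_pair_symm hx q i j k) hy]
  congr 2
  refine Finset.sum_congr rfl fun r _ => ?_
  rw [h.riemann_pair_symm hy r i j k, h.riemann_pair_symm hy q r j k,
    h.riemann_pair_symm hy q i r k, h.riemann_pair_symm hy q i j r]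
  ring

theorem covDeriv4_riemann_antisymm (h : IsMetricOn G U) (hy : y ∈ U) (p i j k l : Fin n) :
    covDeriv4 G (riemann G) p i j k l y = - covDeriv4 G (riemann G) p i j l k y := by
  have e : partialD p (riemann G i j k l) y = - partialD p (riemann G i j l k) y := by
    rw [partialD_congr h.isOpen (v := fun x => (-1) * riemann G i j l k x)
      (fun x hx => by rw [h.riemann_antisymm_right hx]; ring) hy,
      partialD_const_mul (differentiableAt_of_contDiffOn h.isOpen (h.smooth_riemann _ _ _ _) hy)]
    ring
  simp only [covDeriv4, e, sub_eq_add_neg, neg_add, neg_neg, ← Finset.sum_neg_distrib]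
  congr 1
  refine Finset.sum_congr rfl fun q _ => ?_
  rw [h.riemann_antisymm_right hy q j k l, h.riemann_antisymm_right hy i q k l,
    h.riemann_antisymm_right hy i j q l, h.riemann_antisymm_right hy i j k q]
  ring

/-- The trace commutes with the covariant derivative. -/
theorem partialD_trace (h : IsMetricOn G U) (hy : y ∈ U)
    {A : Fin n → Fin n → EuclideanSpace ℝ (Fin n) → ℝ}
    (hA : ∀ i j, ContDiffOn ℝ ∞ (A i j) U) (p : Fin n) :
    partialD p (fun x => ∑ i, ∑ j, invMetric G i j x * A i j x) y =
      ∑ i, ∑ j, invMetric G i j y * covDeriv2 G A p i j y := by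
  have hi : ∀ i j, DifferentiableAt ℝ (invMetric G i j) y := fun i j =>
    differentiableAt_of_contDiffOn h.isOpen (h.smooth_inv i j) hy
  have ha : ∀ i j, DifferentiableAt ℝ (A i j) y := fun i j =>
    differentiableAt_of_contDiffOn h.isOpen (hA i j) hy
  rw [partialD_sum _ fun i _ => DifferentiableAt.fun_sum fun j _ => (hi i j).fun_mul (ha i j),
    Finset.sum_congr rfl fun i _ => partialD_sum _ (fun j _ => (hi i j).fun_mul (ha i j)) p]
  simp only [partialD_mul (hi _ _) (ha _ _), h.partialD_inv hy, covDeriv2, mul_sub,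
    Finset.sum_add_distrib, Finset.sum_sub_distrib, mul_add, neg_mul, add_mul, Finset.sum_mul,
    Finset.mul_sum, neg_add, Finset.sum_neg_distrib]
  have e1 : ∑ i, ∑ j, ∑ q, christoffel G i p q y * invMetric G q j y * A i j y =
      ∑ i, ∑ j, ∑ q, invMetric G i j y * (christoffel G q p i y * A q j y) := by
    rw [Finset.sum_comm]
    conv_rhs => rw [Finset.sum_comm]
    refine Finset.sum_congr rfl fun j _ => ?_
    rw [Finset.sum_comm]
    exact Finset.sum_congr rfl fun r _ => Finset.sum_congr rfl fun q _ => by ring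
  have e2 : ∑ i, ∑ j, ∑ q, christoffel G j p q y * invMetric G i q y * A i j y =
      ∑ i, ∑ j, ∑ q, invMetric G i j y * (christoffel G q p j y * A i q y) := by
    refine Finset.sum_congr rfl fun j _ => ?_
    rw [Finset.sum_comm]
    exact Finset.sum_congr rfl fun r _ => Finset.sum_congr rfl fun q _ => by ring
  rw [e1, e2]
  ring

/-- The twice contracted second Bianchi identity `ds = 2 div Ric`. -/
theorem partialD_scalar (h : IsMetricOn G U) (hy : y ∈ U) (j : Fin n) :
    partialD j (scalar G) y =
      2 * ∑ p, ∑ q, invMetric G p q y * covDeriv2 G (ricci G) p j q y := by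
  have e1 : partialD j (scalar G) y =
      ∑ k, ∑ i, invMetric G k i y * covDeriv2 G (ricci G) j k i y :=
    h.partialD_trace hy h.smooth_ricci j
  -- Both sides are double traces of DR. The once contracted Bianchi identity evaluates the left
  -- side as ds - div Ric, so equality with div Ric gives ds = 2 div Ric.
  have e2 : ∑ k, ∑ i, invMetric G k i y * (∑ r, covCurv G r r j k i y) =
      ∑ p, ∑ q, invMetric G p q y * covDeriv2 G (ricci G) p j q y := by
    have a1 : ∀ k i, ∑ r, covCurv G r r j k i y = ∑ p, ∑ q, invMetric G p q y *
        covDeriv4 G (riemann G) p j k q i y := by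
      intro k i
      refine Finset.sum_congr rfl fun p _ => ?_
      rw [← h.sum_raise_lower hy (fun r => covCurv G p r j k i y) p]
      exact Finset.sum_congr rfl fun q _ => by rw [← h.covDeriv4_riemann hy]
    have a2 : ∀ p q, ∑ k, ∑ i, invMetric G k i y * covDeriv4 G (riemann G) p j k q i y =
        covDeriv2 G (ricci G) p j q y := by
      intro p q
      rw [← h.sum_covCurv hy]
      refine Finset.sum_congr rfl fun k _ => ?_
      rw [← neg_neg (covCurv G p k k j q y), ← h.covCurv_antisymm hy,
        ← h.sum_raise_lower hy (fun r => covCurv G p r j k q y) k, ← Finset.sum_neg_distrib]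
      refine Finset.sum_congr rfl fun i _ => ?_
      rw [← h.covDeriv4_riemann hy, h.covDeriv4_riemann_antisymm hy]
      ring
    simp only [a1, ← a2, Finset.mul_sum]
    calc _ = ∑ k, ∑ p, ∑ i, ∑ q, invMetric G k i y * (invMetric G p q y *
          covDeriv4 G (riemann G) p j k q i y) :=
          Finset.sum_congr rfl fun k _ => Finset.sum_comm
      _ = ∑ p, ∑ k, ∑ i, ∑ q, invMetric G k i y * (invMetric G p q y *
          covDeriv4 G (riemann G) p j k q i y) := Finset.sum_comm
      _ = ∑ p, ∑ k, ∑ q, ∑ i, invMetric G k i y * (invMetric G p q y *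
          covDeriv4 G (riemann G) p j k q i y) :=
          Finset.sum_congr rfl fun p _ => Finset.sum_congr rfl fun k _ => Finset.sum_comm
      _ = ∑ p, ∑ q, ∑ k, ∑ i, invMetric G k i y * (invMetric G p q y *
          covDeriv4 G (riemann G) p j k q i y) :=
          Finset.sum_congr rfl fun p _ => Finset.sum_comm
      _ = _ := Finset.sum_congr rfl fun p _ => Finset.sum_congr rfl fun q _ =>
          Finset.sum_congr rfl fun k _ => Finset.sum_congr rfl fun i _ => by ring
  simp only [h.sum_covCurv_div hy, mul_sub, Finset.sum_sub_distrib, ← e1] at e2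
  have e3 : ∑ k, ∑ i, invMetric G k i y * covDeriv2 G (ricci G) k j i y =
    ∑ p, ∑ q, invMetric G p q y * covDeriv2 G (ricci G) p j q y := rfl
  linarith

/-- The Ricci identity for the Hessian of a function. -/
theorem covDeriv2_hessian (h : IsMetricOn G U) (hy : y ∈ U) {u : EuclideanSpace ℝ (Fin n) → ℝ}
    (hu : ContDiffOn ℝ ∞ u U) (i j k : Fin n) :
    covDeriv2 G (hessian G u) i j k y - covDeriv2 G (hessian G u) j i k y =
      - ∑ l, curvEnd G l i j k y * partialD l u y := by
  have hd : ∀ l, DifferentiableAt ℝ (partialD l u) y := fun l =>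
    differentiableAt_of_contDiffOn h.isOpen (contDiffOn_partialD h.isOpen hu l) hy
  have hdd : ∀ i l, DifferentiableAt ℝ (partialD i (partialD l u)) y := fun i l =>
    differentiableAt_of_contDiffOn h.isOpen
      (contDiffOn_partialD h.isOpen (contDiffOn_partialD h.isOpen hu l) i) hy
  have hc := h.diff_christoffel hy
  have e1 : ∀ i j k, partialD i (hessian G u j k) y = partialD i (partialD j (partialD k u)) y
      - ∑ l, (partialD i (christoffel G l j k) y * partialD l u y
        + christoffel G l j k y * partialD i (partialD l u) y) := by
    intro i j k
    unfold hessian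
    rw [partialD_sub (hdd j k) (DifferentiableAt.fun_sum fun l _ => (hc l j k).fun_mul (hd l)),
      partialD_sum _ fun l _ => (hc l j k).fun_mul (hd l)]
    congr 1
    exact Finset.sum_congr rfl fun l _ => partialD_mul (hc l j k) (hd l) i
  have e2 : partialD i (partialD j (partialD k u)) y = partialD j (partialD i (partialD k u)) y :=
    partialD_comm h.isOpen (contDiffOn_partialD h.isOpen hu k) hy i j
  have e3 : ∀ a b, hessian G u a b y = partialD a (partialD b u) y
      - ∑ l, christoffel G l a b y * partialD l u y := fun a b => rfl
  have e4 : ∑ q, christoffel G q i j y * hessian G u q k y =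
      ∑ q, christoffel G q j i y * hessian G u q k y :=
    Finset.sum_congr rfl fun q _ => by rw [h.christoffel_symm hy]
  have e5 : ∀ i j, ∑ q, christoffel G q i k y * ∑ l, christoffel G l j q y * partialD l u y =
      ∑ l, (∑ q, christoffel G l j q y * christoffel G q i k y) * partialD l u y := by
    intro i j
    simp only [Finset.mul_sum, Finset.sum_mul]
    rw [Finset.sum_comm]
    exact Finset.sum_congr rfl fun l _ => Finset.sum_congr rfl fun q _ => by ring
  simp only [covDeriv2, e1, Finset.sum_add_distrib, e2, e4]
  simp only [e3 i, e3 j, mul_sub, Finset.sum_sub_distrib, e5, curvEnd, add_mul, sub_mul,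
    Finset.sum_add_distrib]
  ring

end IsMetricOn

end Bianchi

/-! ### Linear algebra of tensors of the form η∧g. -/

section Algebra

variable {n : ℕ}

/-- If `(n - 1) η ∧ z + w ∧ g = 0`, where `w = i_v z`, `η = g(v, ·)`, then `z` is a combination of
`η ⊗ η` and `g`. -/
theorem eq_of_wedge_add_wedge_eq_zero (hn : 3 ≤ n) {η w v : Fin n → ℝ} {z g : Fin n → Fin n → ℝ}
    (hz : ∀ i j, z i j = z j i) (hg : ∀ i j, g i j = g j i)
    (hw : ∀ k, ∑ i, v i * z i k = w k) (hη : ∀ k, ∑ i, v i * g i k = η k)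
    (hT : ∀ i j k, ((n : ℝ) - 1) * (η i * z j k - η j * z i k) + (w i * g j k - w j * g i k) = 0)
    (hF : ∑ i, v i * η i ≠ 0) (j k : Fin n) :
    z j k = n * (∑ i, v i * w i) / (((n : ℝ) - 1) * (∑ i, v i * η i) ^ 2) * (η j * η k)
      + -(∑ i, v i * w i) / (((n : ℝ) - 1) * ∑ i, v i * η i) * g j k := by
  have hn' : (3 : ℝ) ≤ n := by exact_mod_cast hn
  set F := ∑ i, v i * η i with hFd
  set c := ∑ i, v i * w i with hcd
  -- Contraction of the first slot of `hT` with v.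
  have c1 : ∀ j k, ((n : ℝ) - 1) * (F * z j k - η j * w k) + (c * g j k - w j * η k) = 0 := by
    intro j k
    have := Finset.sum_eq_zero fun i (_ : i ∈ Finset.univ) => by
      show v i * (((n : ℝ) - 1) * (η i * z j k - η j * z i k) + (w i * g j k - w j * g i k)) = 0
      rw [hT, mul_zero]
    rw [← this, hFd, hcd, ← hw k, ← hη k]
    simp only [Finset.sum_mul, Finset.mul_sum, ← Finset.sum_sub_distrib, ← Finset.sum_add_distrib]
    exact Finset.sum_congr rfl fun i _ => by ring
  -- w is parallel to η: the part of `c1` that is antisymmetric in j and k is η∧w with coefficient n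
  -- - 2, up to sign.
  have c2 : ∀ j k, η j * w k = η k * w j := by
    intro j k
    have e : ((n : ℝ) - 2) * (η j * w k - η k * w j) = 0 := by
      linear_combination c1 k j - c1 j k + ((n : ℝ) - 1) * F * hz j k + c * hg j k
    rcases mul_eq_zero.mp e with e | e
    · linarith
    · linarith
  have c3 : ∀ k, F * w k = c * η k := by
    intro k
    rw [hFd, hcd, Finset.sum_mul, Finset.sum_mul]
    exact Finset.sum_congr rfl fun i _ => by linear_combination v i * c2 i k
  have hn1 : (n : ℝ) - 1 ≠ 0 := by linarith
  field_simp
  linear_combination F * c1 j k + (η j * ((n : ℝ) - 1)) * c3 k + η k * c3 j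

/-- A curvature-like `3`-tensor of the form `α ∧ g + (β ∧ η) ⊗ η` which is orthogonal to `v` in its
last slot and whose trace is parallel to `η = g(v, ·)` is of the form `α ∧ g`. -/
theorem wedge_eq_of_trace (hn : 3 ≤ n) {α β η v : Fin n → ℝ} {g : Fin n → Fin n → ℝ}
    {K : Fin n → Fin n → Fin n → ℝ} {F ν : ℝ} (hη : ∀ j, ∑ k, v k * g j k = η j)
    (hFd : ∑ k, v k * η k = F) (hF : F ≠ 0)
    (hK : ∀ i j k, K i j k = α i * g j k - α j * g i k + (β i * η j - β j * η i) * η k)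
    (hKv : ∀ i j, ∑ k, v k * K i j k = 0)
    (hKt : ∀ i, ((n : ℝ) - 1) * α i + F * β i = ν * η i) (i j k : Fin n) :
    K i j k = α i * g j k - α j * g i k := by
  have hn' : (3 : ℝ) ≤ n := by exact_mod_cast hn
  have c1 : α i * η j - α j * η i + F * (β i * η j - β j * η i) = 0 := by
    have e : ∑ k, v k * K i j k = α i * ∑ k, v k * g j k - α j * ∑ k, v k * g i k
        + (β i * η j - β j * η i) * ∑ k, v k * η k := by
      simp only [hK, Finset.mul_sum, ← Finset.sum_sub_distrib, ← Finset.sum_add_distrib]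
      exact Finset.sum_congr rfl fun k _ => by ring
    rw [hKv, hη, hη, hFd] at e
    linear_combination -e
  -- The exterior product of `hKt` with η reads (n - 1) α∧η + F β∧η = 0, while `c1` reads α∧η + F
  -- β∧η = 0; subtract.
  have c2 : ((n : ℝ) - 2) * (α i * η j - α j * η i) = 0 := by
    linear_combination -c1 + η j * hKt i - η i * hKt j
  have c3 : α i * η j - α j * η i = 0 :=
    (mul_eq_zero.mp c2).resolve_left (by linarith)
  have c4 : β i * η j - β j * η i = 0 := by
    refine (mul_eq_zero.mp ?_).resolve_left hF
    linear_combination c1 - c3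
  rw [hK, c4]
  ring

end Algebra

/-! ### Product rules, traces of η∧g, and trace-freeness of the Cotton and Weyl tensors. -/

section TensorCalculus

variable {n : ℕ} {G : Fin n → Fin n → EuclideanSpace ℝ (Fin n) → ℝ}
  {U : Set (EuclideanSpace ℝ (Fin n))} {y : EuclideanSpace ℝ (Fin n)}
  {A B : Fin n → Fin n → EuclideanSpace ℝ (Fin n) → ℝ} {φ ψ u : EuclideanSpace ℝ (Fin n) → ℝ}

theorem covDeriv2_add (hA : ∀ i j, DifferentiableAt ℝ (A i j) y)
    (hB : ∀ i j, DifferentiableAt ℝ (B i j) y) (p i j : Fin n) :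
    covDeriv2 G (fun a b x => A a b x + B a b x) p i j y =
      covDeriv2 G A p i j y + covDeriv2 G B p i j y := by
  simp only [covDeriv2, partialD_add (hA i j) (hB i j), mul_add, Finset.sum_add_distrib]
  ring

theorem covDeriv2_mul (hφ : DifferentiableAt ℝ φ y) (hA : ∀ i j, DifferentiableAt ℝ (A i j) y)
    (p i j : Fin n) :
    covDeriv2 G (fun a b x => φ x * A a b x) p i j y =
      partialD p φ y * A i j y + φ y * covDeriv2 G A p i j y := by
  simp only [covDeriv2, partialD_mul hφ (hA i j), mul_sub, Finset.mul_sum, mul_add, add_sub_assoc]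
  congr 2
  exact Finset.sum_congr rfl fun q _ => by ring

theorem covDeriv2_partialD_mul (hu : ∀ i, DifferentiableAt ℝ (partialD i u) y) (p i j : Fin n) :
    covDeriv2 G (fun a b x => partialD a u x * partialD b u x) p i j y =
      hessian G u p i y * partialD j u y + partialD i u y * hessian G u p j y := by
  simp only [covDeriv2, hessian, partialD_mul (hu i) (hu j), Finset.sum_add_distrib, sub_mul,
    mul_sub, Finset.sum_mul, Finset.mul_sum]
  rw [Finset.sum_congr rfl (fun q _ => by ring : ∀ q ∈ Finset.univ, partialD i u y *
    (christoffel G q p j y * partialD q u y) =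
    christoffel G q p j y * (partialD i u y * partialD q u y))]
  simp only [mul_assoc]
  ring

/-- The gradient `∇u` in components. -/
noncomputable def gradient (G : Fin n → Fin n → EuclideanSpace ℝ (Fin n) → ℝ)
    (u : EuclideanSpace ℝ (Fin n) → ℝ) (k : Fin n) (y : EuclideanSpace ℝ (Fin n)) : ℝ :=
  ∑ l, invMetric G k l y * partialD l u y

/-- The tensor `Ric - s / (2 (n - 1)) g` whose `d^D` is the Cotton tensor. -/
noncomputable def schouten (G : Fin n → Fin n → EuclideanSpace ℝ (Fin n) → ℝ)
    (a b : Fin n) (y : EuclideanSpace ℝ (Fin n)) : ℝ :=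
  ricci G a b y - scalar G y / (2 * ((n : ℝ) - 1)) * G a b y

namespace IsMetricOn

theorem mono (h : IsMetricOn G U) {V : Set (EuclideanSpace ℝ (Fin n))} (hV : IsOpen V)
    (hVU : V ⊆ U) : IsMetricOn G V :=
  ⟨hV, fun i j => (h.smooth i j).mono hVU, fun y hy => h.posDef y (hVU hy)⟩

theorem trace_metric (h : IsMetricOn G U) (hy : y ∈ U) :
    ∑ i, ∑ j, invMetric G i j y * G i j y = n := by
  have : ∀ i, ∑ j, invMetric G i j y * G i j y = 1 := fun i => by
    rw [Finset.sum_congr rfl fun j _ => by rw [h.symm hy i j], h.inv_mul hy]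
    simp
  simp [this]

theorem contract_left (h : IsMetricOn G U) (hy : y ∈ U) (X : Fin n → ℝ) (k : Fin n) :
    ∑ i, ∑ j, invMetric G i j y * (X j * G i k y) = X k := by
  rw [← h.sum_lower_raise hy X k]
  simp only [Finset.mul_sum]
  exact Finset.sum_congr rfl fun i _ => Finset.sum_congr rfl fun j _ => by ring

theorem contract_right (h : IsMetricOn G U) (hy : y ∈ U) (X : Fin n → ℝ) (k : Fin n) :
    ∑ i, ∑ j, invMetric G i j y * (X i * G k j y) = X k := by
  rw [← h.contract_left hy X k, Finset.sum_comm]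
  exact Finset.sum_congr rfl fun i _ => Finset.sum_congr rfl fun j _ => by
    rw [h.symm hy k i, h.inv_symm hy]

/-- The trace of `η ∧ g` is `(n - 1) η`. -/
theorem trace_wedge (h : IsMetricOn G U) (hy : y ∈ U) (η : Fin n → ℝ) (i : Fin n) :
    ∑ j, ∑ k, invMetric G j k y * (η i * G j k y - η j * G i k y) = ((n : ℝ) - 1) * η i := by
  simp only [mul_sub, Finset.sum_sub_distrib]
  rw [h.contract_right hy η i, ← h.trace_metric hy]
  simp only [Finset.sum_mul, sub_mul, one_mul]
  congr 1
  exact Finset.sum_congr rfl fun i _ => Finset.sum_congr rfl fun j _ => by ring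

/-- A trace-free tensor of the form `η ∧ g` vanishes. -/
theorem eq_zero_of_wedge (h : IsMetricOn G U) (hy : y ∈ U) (hn : 3 ≤ n)
    {X : Fin n → Fin n → Fin n → ℝ} {η : Fin n → ℝ}
    (hX : ∀ i j k, X i j k = η i * G j k y - η j * G i k y)
    (ht : ∀ i, ∑ j, ∑ k, invMetric G j k y * X i j k = 0) (i j k : Fin n) : X i j k = 0 := by
  have hn' : (3 : ℝ) ≤ n := by exact_mod_cast hn
  have hη : ∀ i, η i = 0 := fun i => by
    have := ht i
    simp only [hX, h.trace_wedge hy] at this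
    exact (mul_eq_zero.mp this).resolve_left (by linarith)
  simp [hX, hη]

theorem lower_gradient (h : IsMetricOn G U) (hy : y ∈ U) (k : Fin n) :
    ∑ i, gradient G u i y * G i k y = partialD k u y := by
  rw [← h.sum_lower_raise hy (fun j => partialD j u y) k]
  exact Finset.sum_congr rfl fun i _ => by rw [gradient]; ring

theorem gradContractZ_eq (h : IsMetricOn G U) (hy : y ∈ U) (k : Fin n) :
    gradContractZ G u k y = ∑ i, gradient G u i y * tracelessRicci G i k y := by
  simp only [gradContractZ, gradient, Finset.sum_mul]
  rw [Finset.sum_comm]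
  exact Finset.sum_congr rfl fun i _ => Finset.sum_congr rfl fun j _ => by
    rw [h.inv_symm hy]

theorem tracelessRicci_symm (h : IsMetricOn G U) (hy : y ∈ U) (i j : Fin n) :
    tracelessRicci G i j y = tracelessRicci G j i y := by
  simp only [tracelessRicci, h.ricci_symm hy i j, h.symm hy i j]

theorem trace_tracelessRicci (h : IsMetricOn G U) (hy : y ∈ U) (hn : 3 ≤ n) :
    ∑ i, ∑ j, invMetric G i j y * tracelessRicci G i j y = 0 := by
  have hn' : (3 : ℝ) ≤ n := by exact_mod_cast hn
  have e : ∑ i, ∑ j, invMetric G i j y * tracelessRicci G i j y =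
      scalar G y - scalar G y / n * ∑ i, ∑ j, invMetric G i j y * G i j y := by
    simp only [scalar, tracelessRicci, Finset.mul_sum, ← Finset.sum_sub_distrib]
    exact Finset.sum_congr rfl fun i _ => Finset.sum_congr rfl fun j _ => by ring
  rw [e, h.trace_metric hy]
  field_simp
  ring

theorem norm_gradient_pos (h : IsMetricOn G U) (hy : y ∈ U) (hu : ∃ i, partialD i u y ≠ 0) :
    0 < ∑ i, gradient G u i y * partialD i u y := by
  have := (h.inv_posDef hy).dotProduct_mulVec_pos (x := fun i => partialD i u y) (by
    intro h0
    obtain ⟨i, hi⟩ := hu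
    exact hi (congrFun h0 i))
  simp only [dotProduct, Matrix.mulVec, Pi.star_apply, star_trivial, Matrix.of_apply] at this
  refine this.trans_eq (Finset.sum_congr rfl fun i _ => ?_)
  rw [gradient]; ring

theorem smooth_gradient (h : IsMetricOn G U) (hu : ContDiffOn ℝ ∞ u U) (k : Fin n) :
    ContDiffOn ℝ ∞ (gradient G u k) U :=
  ContDiffOn.sum fun _ _ => (h.smooth_inv _ _).mul (contDiffOn_partialD h.isOpen hu _)

theorem smooth_gradContractZ (h : IsMetricOn G U) (hu : ContDiffOn ℝ ∞ u U) (k : Fin n) :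
    ContDiffOn ℝ ∞ (gradContractZ G u k) U :=
  ContDiffOn.sum fun _ _ => ContDiffOn.sum fun _ _ =>
    ((h.smooth_inv _ _).mul (contDiffOn_partialD h.isOpen hu _)).mul (h.smooth_tracelessRicci _ _)

theorem covDeriv2_add_mul_metric (h : IsMetricOn G U) (hy : y ∈ U)
    (hA : ∀ i j, DifferentiableAt ℝ (A i j) y) (hψ : DifferentiableAt ℝ ψ y) (p i j : Fin n) :
    covDeriv2 G (fun a b x => A a b x + ψ x * G a b x) p i j y =
      covDeriv2 G A p i j y + partialD p ψ y * G i j y := by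
  rw [covDeriv2_add hA fun i j => hψ.fun_mul (h.diff hy i j), covDeriv2_mul hψ (h.diff hy),
    h.covDeriv2_metric hy]
  ring

theorem diff_ricci (h : IsMetricOn G U) (hy : y ∈ U) (i j : Fin n) :
    DifferentiableAt ℝ (ricci G i j) y :=
  differentiableAt_of_contDiffOn h.isOpen (h.smooth_ricci i j) hy

theorem diff_scalar (h : IsMetricOn G U) (hy : y ∈ U) : DifferentiableAt ℝ (scalar G) y :=
  differentiableAt_of_contDiffOn h.isOpen h.smooth_scalar hy

theorem covDeriv2_schouten (h : IsMetricOn G U) (hy : y ∈ U) (p i j : Fin n) :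
    covDeriv2 G (schouten G) p i j y = covDeriv2 G (ricci G) p i j y
      - partialD p (scalar G) y / (2 * ((n : ℝ) - 1)) * G i j y := by
  have e : schouten G = fun a b x => ricci G a b x
      + (-1 / (2 * ((n : ℝ) - 1)) * scalar G x) * G a b x := by
    funext a b x
    rw [schouten]; ring
  rw [e, h.covDeriv2_add_mul_metric hy (h.diff_ricci hy) ((h.diff_scalar hy).const_mul _),
    partialD_const_mul (h.diff_scalar hy)]
  ring

theorem cotton_eq (h : IsMetricOn G U) (hy : y ∈ U) (i j k : Fin n) :
    cotton G i j k y = covDeriv2 G (ricci G) i j k y - covDeriv2 G (ricci G) j i k y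
      - (partialD i (scalar G) y / (2 * ((n : ℝ) - 1)) * G j k y
        - partialD j (scalar G) y / (2 * ((n : ℝ) - 1)) * G i k y) := by
  have : cotton G i j k y = covDeriv2 G (schouten G) i j k y - covDeriv2 G (schouten G) j i k y :=
    rfl
  rw [this, h.covDeriv2_schouten hy, h.covDeriv2_schouten hy]
  ring

/-- The Cotton tensor is trace-free. -/
theorem trace_cotton (h : IsMetricOn G U) (hy : y ∈ U) (hn : 3 ≤ n) (i : Fin n) :
    ∑ j, ∑ k, invMetric G j k y * cotton G i j k y = 0 := by
  have hn' : (3 : ℝ) ≤ n := by exact_mod_cast hn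
  have e1 : partialD i (scalar G) y =
      ∑ k, ∑ l, invMetric G k l y * covDeriv2 G (ricci G) i k l y :=
    h.partialD_trace hy h.smooth_ricci i
  have e2 := h.trace_wedge hy (fun i => partialD i (scalar G) y / (2 * ((n : ℝ) - 1))) i
  have e3 := h.partialD_scalar hy i
  have e : ∑ j, ∑ k, invMetric G j k y * cotton G i j k y =
      ∑ j, ∑ k, invMetric G j k y * covDeriv2 G (ricci G) i j k y
      - ∑ j, ∑ k, invMetric G j k y * covDeriv2 G (ricci G) j i k y
      - ∑ j, ∑ k, invMetric G j k y *
        (partialD i (scalar G) y / (2 * ((n : ℝ) - 1)) * G j k y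
          - partialD j (scalar G) y / (2 * ((n : ℝ) - 1)) * G i k y) := by
    simp only [h.cotton_eq hy, ← Finset.sum_sub_distrib, mul_sub]
  -- The trace of d^D Ric is ds - div Ric = ds/2, and the scalar part of C subtracts (n - 1) ds / (2
  -- (n - 1)), which is the same amount.
  rw [e, e2, ← e1]
  have e4 : ((n : ℝ) - 1) * (partialD i (scalar G) y / (2 * ((n : ℝ) - 1))) =
      partialD i (scalar G) y / 2 := by
    have : (n : ℝ) - 1 ≠ 0 := by linarith
    field_simp
  rw [e4]
  linarith

/-- The trace of `R(·, ·, v, ·)` on the second and the last slots. -/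
theorem trace_riemann (h : IsMetricOn G U) (hy : y ∈ U) (i l : Fin n) :
    ∑ j, ∑ k, invMetric G j k y * riemann G i j l k y = ricci G i l y := by
  rw [h.ricci_eq hy]
  refine Finset.sum_congr rfl fun j _ => Finset.sum_congr rfl fun k _ => ?_
  rw [riemann_antisymm_left, h.riemann_antisymm_right hy]
  ring

theorem sum_gradient_riemann (h : IsMetricOn G U) (hy : y ∈ U) (i j k : Fin n) :
    ∑ l, gradient G u l y * riemann G i j l k y = ∑ l, curvEnd G l i j k y * partialD l u y := by
  simp only [gradient, ← h.sum_inv_riemann hy, Finset.sum_mul]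
  rw [Finset.sum_comm]
  exact Finset.sum_congr rfl fun l _ => Finset.sum_congr rfl fun q _ => by
    rw [h.inv_symm hy]; ring

/-- The trace of a Kulkarni–Nomizu product A∧g is (n - 2) A + (tr A) g. With the coefficients in
`weyl`, the two products therefore contribute (s/n) g and z, which together cancel Ric. -/
theorem trace_weyl (h : IsMetricOn G U) (hy : y ∈ U) (hn : 3 ≤ n) (i l : Fin n) :
    ∑ j, ∑ k, invMetric G j k y * weyl G i j l k y = 0 := by
  have hn' : (3 : ℝ) ≤ n := by exact_mod_cast hn
  have hKN : ∀ A : Fin n → Fin n → EuclideanSpace ℝ (Fin n) → ℝ,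
      ∑ j, ∑ k, invMetric G j k y * kulkarniNomizu A G i j l k y =
      n * A i l y + (∑ j, ∑ k, invMetric G j k y * A j k y) * G i l y - A i l y - A i l y := by
    intro A
    have e1 := h.contract_right hy (fun j => A j l y) i
    have e2 := h.contract_left hy (fun k => A i k y) l
    rw [← h.trace_metric hy]
    conv_rhs => rw [sub_sub, add_comm (A i l y)]
    conv_rhs => enter [2, 1]; rw [← e1]
    conv_rhs => enter [2, 2]; rw [← e2]
    simp only [kulkarniNomizu, Finset.sum_mul, ← Finset.sum_add_distrib, ← Finset.sum_sub_distrib]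
    exact Finset.sum_congr rfl fun i _ => Finset.sum_congr rfl fun j _ => by ring
  have e : ∑ j, ∑ k, invMetric G j k y * weyl G i j l k y =
      ∑ j, ∑ k, invMetric G j k y * riemann G i j l k y
      - scalar G y / (2 * n * ((n : ℝ) - 1)) *
        ∑ j, ∑ k, invMetric G j k y * kulkarniNomizu G G i j l k y
      - 1 / ((n : ℝ) - 2) *
        ∑ j, ∑ k, invMetric G j k y * kulkarniNomizu (tracelessRicci G) G i j l k y := by
    simp only [weyl, Finset.mul_sum, ← Finset.sum_sub_distrib]
    exact Finset.sum_congr rfl fun i _ => Finset.sum_congr rfl fun j _ => by ring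
  rw [e, h.trace_riemann hy, hKN, hKN, h.trace_metric hy, h.trace_tracelessRicci hy hn]
  have h1 : (n : ℝ) - 1 ≠ 0 := by linarith
  have h2 : (n : ℝ) - 2 ≠ 0 := by linarith
  simp only [tracelessRicci]
  field_simp
  ring

theorem weyl_antisymm_right (h : IsMetricOn G U) (hy : y ∈ U) (i j k l : Fin n) :
    weyl G i j k l y = - weyl G i j l k y := by
  simp only [weyl, kulkarniNomizu, h.riemann_antisymm_right hy i j k l]
  ring

end IsMetricOn

end TensorCalculus

/-! ### Local consequences of the Einstein equation and T = 0. -/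

section LocalEinstein

variable {n : ℕ} {G : Fin n → Fin n → EuclideanSpace ℝ (Fin n) → ℝ}
  {U : Set (EuclideanSpace ℝ (Fin n))} {y : EuclideanSpace ℝ (Fin n)}
  {u L : EuclideanSpace ℝ (Fin n) → ℝ} {m : ℝ}

theorem sum_trace_comm (c : Fin n → Fin n → ℝ) (v : Fin n → ℝ) (X : Fin n → Fin n → Fin n → ℝ) :
    ∑ j, ∑ k, c j k * ∑ l, v l * X j l k = ∑ l, v l * ∑ j, ∑ k, c j k * X j l k := by
  simp only [Finset.mul_sum]
  calc _ = ∑ j, ∑ l, ∑ k, c j k * (v l * X j l k) :=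
        Finset.sum_congr rfl fun j _ => Finset.sum_comm
    _ = ∑ l, ∑ j, ∑ k, c j k * (v l * X j l k) := Finset.sum_comm
    _ = _ := Finset.sum_congr rfl fun l _ => Finset.sum_congr rfl fun j _ =>
        Finset.sum_congr rfl fun k _ => by ring

/-- T = 0 with its denominators cleared. It is used both to determine z and to replace du∧z by a
tensor of the form η∧g. -/
theorem wedge_of_structureT (hn : 3 ≤ n) {i j k : Fin n} (hT : structureT G u i j k y = 0) :
    ((n : ℝ) - 1) * (partialD i u y * tracelessRicci G j k y
      - partialD j u y * tracelessRicci G i k y)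
      + (gradContractZ G u i y * G j k y - gradContractZ G u j y * G i k y) = 0 := by
  have hn' : (3 : ℝ) ≤ n := by exact_mod_cast hn
  have h1 : (n : ℝ) - 1 ≠ 0 := by linarith
  have h2 : (n : ℝ) - 2 ≠ 0 := by linarith
  simp only [structureT, wedge12] at hT
  field_simp at hT
  linear_combination hT

namespace IsMetricOn

/-- The coefficient of `du ⊗ du` in the traceless Ricci tensor when the structure tensor of `u`
vanishes. -/
noncomputable def zCoeffGrad (G : Fin n → Fin n → EuclideanSpace ℝ (Fin n) → ℝ)
    (u : EuclideanSpace ℝ (Fin n) → ℝ) (y : EuclideanSpace ℝ (Fin n)) : ℝ :=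
  n * (∑ i, gradient G u i y * gradContractZ G u i y) /
    (((n : ℝ) - 1) * (∑ i, gradient G u i y * partialD i u y) ^ 2)

/-- The coefficient of the metric in the traceless Ricci tensor when the structure tensor of `u`
vanishes. -/
noncomputable def zCoeffMetric (G : Fin n → Fin n → EuclideanSpace ℝ (Fin n) → ℝ)
    (u : EuclideanSpace ℝ (Fin n) → ℝ) (y : EuclideanSpace ℝ (Fin n)) : ℝ :=
  -(∑ i, gradient G u i y * gradContractZ G u i y) /
    (((n : ℝ) - 1) * ∑ i, gradient G u i y * partialD i u y)

/-- Contracting T = 0 with ∇u makes i_{∇u}z parallel to du, and then determines z completely. -/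
theorem tracelessRicci_eq (h : IsMetricOn G U) (hn : 3 ≤ n) (hy : y ∈ U)
    (hT : ∀ i j k, structureT G u i j k y = 0)
    (hF : ∑ i, gradient G u i y * partialD i u y ≠ 0) (j k : Fin n) :
    tracelessRicci G j k y = zCoeffGrad G u y * (partialD j u y * partialD k u y)
      + zCoeffMetric G u y * G j k y :=
  eq_of_wedge_add_wedge_eq_zero hn (h.tracelessRicci_symm hy) (h.symm hy)
    (fun k => (h.gradContractZ_eq hy k).symm) (h.lower_gradient hy)
    (fun i j k => wedge_of_structureT hn (hT i j k)) hF j k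

theorem smooth_norm_gradient (h : IsMetricOn G U) (hu : ContDiffOn ℝ ∞ u U) :
    ContDiffOn ℝ ∞ (fun y => ∑ i, gradient G u i y * partialD i u y) U :=
  ContDiffOn.sum fun i _ => (h.smooth_gradient hu i).mul (contDiffOn_partialD h.isOpen hu i)

theorem smooth_zCoeffGrad (h : IsMetricOn G U) (hn : 3 ≤ n) (hu : ContDiffOn ℝ ∞ u U)
    (hF : ∀ y ∈ U, ∑ i, gradient G u i y * partialD i u y ≠ 0) :
    ContDiffOn ℝ ∞ (zCoeffGrad G u) U := by
  have hn' : (3 : ℝ) ≤ n := by exact_mod_cast hn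
  refine (contDiffOn_const.mul (ContDiffOn.sum fun i _ =>
    (h.smooth_gradient hu i).mul (h.smooth_gradContractZ hu i))).div
    (contDiffOn_const.mul ((h.smooth_norm_gradient hu).pow 2)) fun y hy => ?_
  exact mul_ne_zero (by linarith) (pow_ne_zero 2 (hF y hy))

theorem smooth_zCoeffMetric (h : IsMetricOn G U) (hn : 3 ≤ n) (hu : ContDiffOn ℝ ∞ u U)
    (hF : ∀ y ∈ U, ∑ i, gradient G u i y * partialD i u y ≠ 0) :
    ContDiffOn ℝ ∞ (zCoeffMetric G u) U := by
  have hn' : (3 : ℝ) ≤ n := by exact_mod_cast hn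
  refine (ContDiffOn.sum fun i _ =>
    (h.smooth_gradient hu i).mul (h.smooth_gradContractZ hu i)).neg.div
    (contDiffOn_const.mul (h.smooth_norm_gradient hu)) fun y hy => ?_
  exact mul_ne_zero (by linarith) (hF y hy)

theorem ricci_eq_tracelessRicci (i j : Fin n) :
    ricci G i j y = tracelessRicci G i j y + scalar G y / n * G i j y := by
  rw [tracelessRicci]; ring

/-- Where `du` does not vanish, `R(·, ·, ∇u, ·)` has the form `β ∧ g`. -/
theorem curvature_gradient_of_ne_zero (h : IsMetricOn G U) (hn : 3 ≤ n)
    (hu : ContDiffOn ℝ ∞ u U) (hL : ContDiffOn ℝ ∞ L U)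
    (hE : ∀ y ∈ U, ∀ i j, hessian G u i j y = u y / m * (ricci G i j y - L y * G i j y))
    (hT : ∀ y ∈ U, ∀ i j k, structureT G u i j k y = 0)
    (hF : ∀ y ∈ U, ∑ i, gradient G u i y * partialD i u y ≠ 0) (hy : y ∈ U) :
    ∃ β : Fin n → ℝ, ∀ i j k, ∑ l, curvEnd G l i j k y * partialD l u y =
      β i * G j k y - β j * G i k y := by
  set p := zCoeffGrad G u
  set q := zCoeffMetric G u
  have hz : ∀ x ∈ U, ∀ j k, tracelessRicci G j k x =
      p x * (partialD j u x * partialD k u x) + q x * G j k x :=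
    fun x hx => h.tracelessRicci_eq hn hx (hT x hx) (hF x hx)
  -- Coefficients of the Hessian, Ddu = b du⊗du + a g, obtained by inserting the form of z into the
  -- Einstein equation.
  let b : EuclideanSpace ℝ (Fin n) → ℝ := fun x => u x / m * p x
  let a : EuclideanSpace ℝ (Fin n) → ℝ := fun x => u x / m * (q x + scalar G x / n - L x)
  have hb : DifferentiableAt ℝ b y := differentiableAt_of_contDiffOn h.isOpen
    ((hu.div_const m).mul (h.smooth_zCoeffGrad hn hu hF)) hy
  have ha : DifferentiableAt ℝ a y := differentiableAt_of_contDiffOn h.isOpen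
    ((hu.div_const m).mul (((h.smooth_zCoeffMetric hn hu hF).add
      (h.smooth_scalar.div_const _)).sub hL)) hy
  have hdu : ∀ i, DifferentiableAt ℝ (partialD i u) y := fun i =>
    differentiableAt_of_contDiffOn h.isOpen (contDiffOn_partialD h.isOpen hu i) hy
  have hH : ∀ x ∈ U, ∀ i j, hessian G u i j x =
      b x * (partialD i u x * partialD j u x) + a x * G i j x := by
    intro x hx i j
    rw [hE x hx, ricci_eq_tracelessRicci, hz x hx]
    simp only [a, b]
    ring
  have hD : ∀ s i j, covDeriv2 G (hessian G u) s i j y =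
      partialD s b y * (partialD i u y * partialD j u y) +
      b y * (hessian G u s i y * partialD j u y + partialD i u y * hessian G u s j y)
      + partialD s a y * G i j y := by
    intro s i j
    rw [covDeriv2_congr h.isOpen hH hy, h.covDeriv2_add_mul_metric hy
      (fun i j => hb.fun_mul ((hdu i).fun_mul (hdu j))) ha,
      covDeriv2_mul hb (fun i j => (hdu i).fun_mul (hdu j)), covDeriv2_partialD_mul hdu]
  set v : Fin n → ℝ := fun k => gradient G u k y
  set F := ∑ i, v i * partialD i u y with hFdef
  -- When Ddu is substituted for itself in D(du⊗du), the b² terms cancel and the ab terms give -ab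
  -- du∧g, hence the correction to da.
  let α : Fin n → ℝ := fun i => partialD i a y - a y * b y * partialD i u y
  have hK : ∀ i j k, -∑ l, curvEnd G l i j k y * partialD l u y =
      α i * G j k y - α j * G i k y +
      (partialD i b y * partialD j u y - partialD j b y * partialD i u y) * partialD k u y := by
    intro i j k
    rw [← h.covDeriv2_hessian hy hu, hD, hD, hH y hy, hH y hy, hH y hy, hH y hy, h.symm hy j i]
    simp only [α]
    ring
  have hKR : ∀ i j k, -∑ l, curvEnd G l i j k y * partialD l u y =
      -∑ l, v l * riemann G i j l k y := fun i j k => by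
    rw [← h.sum_gradient_riemann hy]
  refine ⟨fun i => - α i, fun i j k => ?_⟩
  have hη : ∀ j, ∑ k, v k * G j k y = partialD j u y := fun j => by
    rw [← h.lower_gradient hy j]
    exact Finset.sum_congr rfl fun k _ => by rw [h.symm hy j k]
  have main := wedge_eq_of_trace hn (α := α) (β := fun i => partialD i b y)
    (η := fun i => partialD i u y) (v := v) (g := fun i j => G i j y)
    (K := fun i j k => -∑ l, curvEnd G l i j k y * partialD l u y) (F := F)
    -- The trace of -R(·,·,∇u,·) is -Ric(∇u) = -(p F + q + s/n) du; the trace of (db∧du)⊗du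
    -- contributes the remaining multiple of du, namely ⟨∇u, db⟩.
    (ν := ∑ k, v k * partialD k b y - (p y * F + (q y + scalar G y / n)))
    hη rfl (hF y hy) hK ?_ ?_ i j k
  · linear_combination -main
  · intro i j
    -- R(·,·,∇u,∇u) equals its own negative by antisymmetry in the last two slots.
    have e : ∑ k, v k * ∑ l, v l * riemann G i j l k y =
        -∑ k, v k * ∑ l, v l * riemann G i j l k y := by
      conv_lhs => simp only [Finset.mul_sum]
      rw [Finset.sum_comm, ← Finset.sum_neg_distrib]
      refine Finset.sum_congr rfl fun k _ => ?_
      rw [Finset.mul_sum, ← Finset.sum_neg_distrib]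
      exact Finset.sum_congr rfl fun l _ => by rw [h.riemann_antisymm_right hy i j k l]; ring
    simp only [hKR, mul_neg, Finset.sum_neg_distrib]
    linarith
  · intro i
    have e1 : ∑ j, ∑ k, invMetric G j k y * (-∑ l, curvEnd G l i j k y * partialD l u y) =
        -((p y * F + (q y + scalar G y / n)) * partialD i u y) := by
      simp only [hKR, mul_neg, Finset.sum_neg_distrib]
      rw [sum_trace_comm _ v fun j l k => riemann G i j l k y]
      simp only [h.trace_riemann hy, ricci_eq_tracelessRicci i, hz y hy]
      have e0 : ∑ l, v l * (p y * (partialD i u y * partialD l u y) + q y * G i l y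
          + scalar G y / n * G i l y) =
          p y * F * partialD i u y + (q y + scalar G y / n) * ∑ l, v l * G i l y := by
        simp only [hFdef, Finset.mul_sum, Finset.sum_mul, ← Finset.sum_add_distrib]
        exact Finset.sum_congr rfl fun l _ => by ring
      rw [e0, hη i]
      ring
    have e2 : ∑ j, ∑ k, invMetric G j k y * ((partialD i b y * partialD j u y
          - partialD j b y * partialD i u y) * partialD k u y) =
        F * partialD i b y - (∑ k, v k * partialD k b y) * partialD i u y := by
      simp only [hFdef, v, gradient, Finset.sum_mul, ← Finset.sum_sub_distrib]
      exact Finset.sum_congr rfl fun j _ => Finset.sum_congr rfl fun k _ => by ring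
    have e3 := h.trace_wedge hy α i
    simp only [hK, mul_add, Finset.sum_add_distrib] at e1
    rw [e2, e3] at e1
    linear_combination e1

/-- If the structure tensor vanishes then `R(·, ·, ∇u, ·)` has the form `β ∧ g`. -/
theorem curvature_gradient (h : IsMetricOn G U) (hn : 3 ≤ n)
    (hu : ContDiffOn ℝ ∞ u U) (hL : ContDiffOn ℝ ∞ L U)
    (hE : ∀ y ∈ U, ∀ i j, hessian G u i j y = u y / m * (ricci G i j y - L y * G i j y))
    (hT : ∀ y ∈ U, ∀ i j k, structureT G u i j k y = 0) (hy : y ∈ U) :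
    ∃ β : Fin n → ℝ, ∀ i j k, ∑ l, curvEnd G l i j k y * partialD l u y =
      β i * G j k y - β j * G i k y := by
  by_cases hd : ∃ i, partialD i u y ≠ 0
  · let V := U ∩ (fun y => ∑ i, gradient G u i y * partialD i u y) ⁻¹' {0}ᶜ
    have hV : IsOpen V := (h.smooth_norm_gradient hu).continuousOn.isOpen_inter_preimage h.isOpen
      isOpen_compl_singleton
    have hVU : V ⊆ U := Set.inter_subset_left
    exact (h.mono hV hVU).curvature_gradient_of_ne_zero hn (hu.mono hVU) (hL.mono hVU)
      (fun y hy => hE y (hVU hy)) (fun y hy => hT y (hVU hy)) (fun y hy => hy.2)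
      ⟨hy, (h.norm_gradient_pos hy hd).ne'⟩
  · push Not at hd
    exact ⟨0, fun i j k => by simp [hd]⟩

/-- If the structure tensor vanishes then `f C = 0`. -/
theorem mul_cotton_eq_zero (h : IsMetricOn G U) (hn : 3 ≤ n) (hm : m ≠ 0)
    (hu : ContDiffOn ℝ ∞ u U) (hL : ContDiffOn ℝ ∞ L U)
    (hE : ∀ y ∈ U, ∀ i j, hessian G u i j y = u y / m * (ricci G i j y - L y * G i j y))
    (hT : ∀ y ∈ U, ∀ i j k, structureT G u i j k y = 0) (hy : y ∈ U) (i j k : Fin n) :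
    u y * cotton G i j k y = 0 := by
  have hn' : (3 : ℝ) ≤ n := by exact_mod_cast hn
  have hn1 : (n : ℝ) - 1 ≠ 0 := by linarith
  obtain ⟨β, hβ⟩ := h.curvature_gradient hn hu hL hE hT hy
  have hud := differentiableAt_of_contDiffOn h.isOpen hu hy
  have hφ : DifferentiableAt ℝ (fun x => m⁻¹ * u x) y := hud.const_mul _
  let ψ : EuclideanSpace ℝ (Fin n) → ℝ := fun x => -(u x / m * L x)
  have hψ : DifferentiableAt ℝ ψ y := differentiableAt_of_contDiffOn h.isOpen
    ((hu.div_const m).mul hL).neg hy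
  have hH : ∀ x ∈ U, ∀ i j, hessian G u i j x =
      (m⁻¹ * u x) * ricci G i j x + ψ x * G i j x := by
    intro x hx i j
    rw [hE x hx]
    simp only [ψ]
    ring
  have hD : ∀ s i j, covDeriv2 G (hessian G u) s i j y =
      m⁻¹ * partialD s u y * ricci G i j y + m⁻¹ * u y * covDeriv2 G (ricci G) s i j y
      + partialD s ψ y * G i j y := by
    intro s i j
    rw [covDeriv2_congr h.isOpen hH hy, h.covDeriv2_add_mul_metric hy
      (fun i j => hφ.fun_mul (h.diff_ricci hy i j)) hψ, covDeriv2_mul hφ (h.diff_ricci hy),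
      partialD_const_mul hud]
  -- Collects every multiple of g in m d^D(Ddu): the curvature term β, the part of du∧z supplied by
  -- T = 0, the scalar part of Ric, the term in λ, and the scalar correction in C.
  let η : Fin n → ℝ := fun i => -m * β i + gradContractZ G u i y / ((n : ℝ) - 1)
    - partialD i u y * (scalar G y / n) - m * partialD i ψ y
    - u y * (partialD i (scalar G) y / (2 * ((n : ℝ) - 1)))
  refine h.eq_zero_of_wedge hy hn (X := fun i j k => u y * cotton G i j k y) (η := η) ?_ ?_ i j k
  · intro i j k
    have e1 := h.covDeriv2_hessian hy hu i j k
    rw [hD, hD, hβ, ricci_eq_tracelessRicci, ricci_eq_tracelessRicci] at e1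
    have e2 : partialD i u y * tracelessRicci G j k y - partialD j u y * tracelessRicci G i k y =
        -(gradContractZ G u i y * G j k y - gradContractZ G u j y * G i k y) / ((n : ℝ) - 1) := by
      rw [eq_div_iff hn1]
      linear_combination wedge_of_structureT hn (hT y hy i j k)
    have e3 : m * m⁻¹ = 1 := mul_inv_cancel₀ hm
    rw [h.cotton_eq hy]
    simp only [η]
    linear_combination m * e1 - e2 - (partialD i u y * (tracelessRicci G j k y
      + scalar G y / n * G j k y) - partialD j u y * (tracelessRicci G i k y
      + scalar G y / n * G i k y) + u y * (covDeriv2 G (ricci G) i j k y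
      - covDeriv2 G (ricci G) j i k y)) * e3
  · intro i
    have := h.trace_cotton hy hn i
    calc _ = u y * ∑ j, ∑ k, invMetric G j k y * cotton G i j k y := by
          simp only [Finset.mul_sum]
          exact Finset.sum_congr rfl fun j _ => Finset.sum_congr rfl fun k _ => by ring
      _ = 0 := by rw [this, mul_zero]

/-- If the structure tensor vanishes then `W(·, ·, ∇u, ·) = 0`. -/
theorem weyl_gradient (h : IsMetricOn G U) (hn : 3 ≤ n)
    (hu : ContDiffOn ℝ ∞ u U) (hL : ContDiffOn ℝ ∞ L U)
    (hE : ∀ y ∈ U, ∀ i j, hessian G u i j y = u y / m * (ricci G i j y - L y * G i j y))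
    (hT : ∀ y ∈ U, ∀ i j k, structureT G u i j k y = 0) (hy : y ∈ U) (i j k : Fin n) :
    ∑ l, gradient G u l y * weyl G i j l k y = 0 := by
  have hn' : (3 : ℝ) ≤ n := by exact_mod_cast hn
  have hn1 : (n : ℝ) - 1 ≠ 0 := by linarith
  obtain ⟨β, hβ⟩ := h.curvature_gradient hn hu hL hE hT hy
  let w : Fin n → ℝ := fun i => gradContractZ G u i y
  -- Contracting with ∇u, g∧g contributes 2 du∧g, while z∧g contributes w∧g + du∧z, which T = 0
  -- turns into (1 - 1/(n - 1)) w∧g.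
  let η : Fin n → ℝ := fun i => β i
    - scalar G y / (2 * n * ((n : ℝ) - 1)) * (2 * partialD i u y)
    - 1 / ((n : ℝ) - 2) * (w i - w i / ((n : ℝ) - 1))
  have hG : ∀ i, ∑ l, gradient G u l y * G i l y = partialD i u y := fun i => by
    rw [← h.lower_gradient hy i]
    exact Finset.sum_congr rfl fun k _ => by rw [h.symm hy i k]
  have hZ : ∀ i, ∑ l, gradient G u l y * tracelessRicci G i l y = w i := fun i => by
    simp only [w]
    rw [h.gradContractZ_eq hy i]
    exact Finset.sum_congr rfl fun k _ => by rw [h.tracelessRicci_symm hy i k]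
  have hKN : ∀ A : Fin n → Fin n → EuclideanSpace ℝ (Fin n) → ℝ, ∀ i j k,
      ∑ l, gradient G u l y * kulkarniNomizu A G i j l k y =
      (∑ l, gradient G u l y * A i l y) * G j k y
      + A j k y * ∑ l, gradient G u l y * G i l y
      - A i k y * ∑ l, gradient G u l y * G j l y
      - (∑ l, gradient G u l y * A j l y) * G i k y := by
    intro A i j k
    simp only [kulkarniNomizu, Finset.sum_mul, Finset.mul_sum, ← Finset.sum_add_distrib,
      ← Finset.sum_sub_distrib]
    exact Finset.sum_congr rfl fun l _ => by ring
  refine h.eq_zero_of_wedge hy hn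
    (X := fun i j k => ∑ l, gradient G u l y * weyl G i j l k y) (η := η) ?_ ?_ i j k
  · intro i j k
    have e : ∑ l, gradient G u l y * weyl G i j l k y =
        ∑ l, gradient G u l y * riemann G i j l k y
        - scalar G y / (2 * n * ((n : ℝ) - 1)) *
          ∑ l, gradient G u l y * kulkarniNomizu G G i j l k y
        - 1 / ((n : ℝ) - 2) *
          ∑ l, gradient G u l y * kulkarniNomizu (tracelessRicci G) G i j l k y := by
      simp only [weyl, Finset.mul_sum, ← Finset.sum_sub_distrib]
      exact Finset.sum_congr rfl fun l _ => by ring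
    have e2 : partialD i u y * tracelessRicci G j k y - partialD j u y * tracelessRicci G i k y =
        -(w i * G j k y - w j * G i k y) / ((n : ℝ) - 1) := by
      rw [eq_div_iff hn1]
      linear_combination wedge_of_structureT hn (hT y hy i j k)
    rw [e, h.sum_gradient_riemann hy, hβ, hKN, hKN, hG, hG, hZ, hZ]
    simp only [η]
    linear_combination -(1 / ((n : ℝ) - 2)) * e2
  · intro i
    rw [sum_trace_comm _ (fun l => gradient G u l y) fun j l k => weyl G i j l k y]
    simp [h.trace_weyl hy hn]

/-- Here z = p du⊗du + q g. The first part is killed by W(·,·,∇u,·) = 0, the second because W is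
trace-free. -/
theorem weylRing_eq_zero_of_gradient (h : IsMetricOn G U) (hn : 3 ≤ n)
    (hu : ContDiffOn ℝ ∞ u U) (hL : ContDiffOn ℝ ∞ L U)
    (hE : ∀ y ∈ U, ∀ i j, hessian G u i j y = u y / m * (ricci G i j y - L y * G i j y))
    (hT : ∀ y ∈ U, ∀ i j k, structureT G u i j k y = 0) (hy : y ∈ U)
    (hd : ∃ i, partialD i u y ≠ 0) (i j : Fin n) : weylRing G i j y = 0 := by
  have hz := h.tracelessRicci_eq hn hy (hT y hy) (h.norm_gradient_pos hy hd).ne'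
  have hW : ∀ a, ∑ b, gradient G u b y * weyl G i a j b y = 0 := by
    intro a
    have := h.weyl_gradient hn hu hL hE hT hy i a j
    rw [← neg_eq_zero, ← this, ← Finset.sum_neg_distrib]
    exact Finset.sum_congr rfl fun b _ => by rw [h.weyl_antisymm_right hy]; ring
  have hin : ∀ a c, ∑ b, ∑ d, invMetric G b d y * (weyl G i a j b y * tracelessRicci G c d y) =
      zCoeffMetric G u y * weyl G i a j c y := by
    intro a c
    have e1 := h.contract_right hy (fun b => weyl G i a j b y) c
    calc _ = zCoeffGrad G u y * partialD c u y * ∑ b, gradient G u b y * weyl G i a j b y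
          + zCoeffMetric G u y * ∑ b, ∑ d, invMetric G b d y * (weyl G i a j b y * G c d y) := by
          simp only [hz, gradient, Finset.mul_sum, Finset.sum_mul, ← Finset.sum_add_distrib]
          exact Finset.sum_congr rfl fun b _ => Finset.sum_congr rfl fun d _ => by ring
      _ = _ := by rw [hW, e1]; ring
  have e : weylRing G i j y = ∑ a, ∑ c, invMetric G a c y *
      ∑ b, ∑ d, invMetric G b d y * (weyl G i a j b y * tracelessRicci G c d y) := by
    simp only [weylRing, Finset.mul_sum]
    refine Finset.sum_congr rfl fun a _ => ?_
    rw [Finset.sum_comm]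
    exact Finset.sum_congr rfl fun c _ => Finset.sum_congr rfl fun b _ =>
      Finset.sum_congr rfl fun d _ => by ring
  rw [e]
  simp only [hin]
  calc _ = zCoeffMetric G u y * ∑ a, ∑ c, invMetric G a c y * weyl G i a j c y := by
        simp only [Finset.mul_sum]
        exact Finset.sum_congr rfl fun a _ => Finset.sum_congr rfl fun c _ => by ring
    _ = 0 := by rw [h.trace_weyl hy hn, mul_zero]

/-- Where `u` is locally constant, `u z = 0`. -/
theorem mul_tracelessRicci_eq_zero (h : IsMetricOn G U) (hn : 3 ≤ n) (hm : m ≠ 0)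
    (hE : ∀ y ∈ U, ∀ i j, hessian G u i j y = u y / m * (ricci G i j y - L y * G i j y))
    (hd : ∀ y ∈ U, ∀ i, partialD i u y = 0) (hy : y ∈ U) (i j : Fin n) :
    u y * tracelessRicci G i j y = 0 := by
  have hn' : (3 : ℝ) ≤ n := by exact_mod_cast hn
  have hH : ∀ i j, hessian G u i j y = 0 := by
    intro i j
    have e : partialD i (partialD j u) y = 0 := by
      rw [partialD_congr h.isOpen (fun x hx => hd x hx j) hy, partialD_const]
    simp [hessian, e, hd y hy]
  have hR : ∀ i j, u y * ricci G i j y = u y * L y * G i j y := by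
    intro i j
    have := hE y hy i j
    rw [hH] at this
    field_simp at this
    linear_combination -this
  have hs : u y * scalar G y = u y * L y * n := by
    rw [← h.trace_metric hy]
    simp only [scalar, Finset.mul_sum]
    exact Finset.sum_congr rfl fun i _ => Finset.sum_congr rfl fun j _ => by
      linear_combination invMetric G i j y * hR i j
  rw [tracelessRicci, mul_sub, hR, div_mul_eq_mul_div, ← mul_div_assoc, ← mul_assoc, hs]
  have : (n : ℝ) ≠ 0 := by linarith
  field_simp
  ring

/-- On the open set where this component of W°z is nonzero, du must vanish. There u z = 0, so u W°z
= 0 and u vanishes on a nonempty open set, a contradiction. -/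
theorem weylRing_eq_zero (h : IsMetricOn G U) (hn : 3 ≤ n) (hm : m ≠ 0)
    (hu : ContDiffOn ℝ ∞ u U) (hL : ContDiffOn ℝ ∞ L U)
    (hE : ∀ y ∈ U, ∀ i j, hessian G u i j y = u y / m * (ricci G i j y - L y * G i j y))
    (hT : ∀ y ∈ U, ∀ i j k, structureT G u i j k y = 0)
    (hnz : ∀ y ∈ U, ¬ ∀ᶠ x in 𝓝 y, u x = 0) (hy : y ∈ U) (i j : Fin n) :
    weylRing G i j y = 0 := by
  by_contra hne
  let V := U ∩ (weylRing G i j) ⁻¹' {0}ᶜ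
  have hV : IsOpen V := (h.smooth_weylRing i j).continuousOn.isOpen_inter_preimage h.isOpen
    isOpen_compl_singleton
  have hVU : V ⊆ U := Set.inter_subset_left
  have hd : ∀ x ∈ V, ∀ i, partialD i u x = 0 := by
    intro x hx a
    by_contra ha
    exact hx.2 (h.weylRing_eq_zero_of_gradient hn hu hL hE hT hx.1 ⟨a, ha⟩ i j)
  refine hnz y hy (Filter.mem_of_superset (hV.mem_nhds ⟨hy, hne⟩) fun x hx => ?_)
  have hz := (h.mono hV hVU).mul_tracelessRicci_eq_zero hn hm (fun y hy => hE y (hVU hy)) hd hx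
  have : u x * weylRing G i j x = 0 := by
    simp only [weylRing, Finset.mul_sum]
    refine Finset.sum_eq_zero fun a _ => Finset.sum_eq_zero fun b _ => Finset.sum_eq_zero fun c _ =>
      Finset.sum_eq_zero fun d _ => ?_
    linear_combination invMetric G a c x * invMetric G b d x * weyl G i a j b x * hz c d
  exact (mul_eq_zero.mp this).resolve_right hx.2

/-- Since u C = 0, a nonzero component of C would make u vanish on the open set where that component
is nonzero. -/
theorem cotton_eq_zero (h : IsMetricOn G U) (hn : 3 ≤ n) (hm : m ≠ 0)
    (hu : ContDiffOn ℝ ∞ u U) (hL : ContDiffOn ℝ ∞ L U)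
    (hE : ∀ y ∈ U, ∀ i j, hessian G u i j y = u y / m * (ricci G i j y - L y * G i j y))
    (hT : ∀ y ∈ U, ∀ i j k, structureT G u i j k y = 0)
    (hnz : ∀ y ∈ U, ¬ ∀ᶠ x in 𝓝 y, u x = 0) (hy : y ∈ U) (i j k : Fin n) :
    cotton G i j k y = 0 := by
  by_contra hne
  have hV : IsOpen (U ∩ (cotton G i j k) ⁻¹' {0}ᶜ) :=
    (h.smooth_cotton i j k).continuousOn.isOpen_inter_preimage h.isOpen isOpen_compl_singleton
  refine hnz y hy (Filter.mem_of_superset (hV.mem_nhds ⟨hy, hne⟩) fun x hx => ?_)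
  exact (mul_eq_zero.mp (h.mul_cotton_eq_zero hn hm hu hL hE hT hx.1 i j k)).resolve_right hx.2

end IsMetricOn

end LocalEinstein

/-! ### Divergence of the Weyl tensor, and the Bach tensor. -/

section DivergenceWeyl

variable {n : ℕ} {G : Fin n → Fin n → EuclideanSpace ℝ (Fin n) → ℝ}
  {U : Set (EuclideanSpace ℝ (Fin n))} {y : EuclideanSpace ℝ (Fin n)}
  {A : Fin n → Fin n → EuclideanSpace ℝ (Fin n) → ℝ}

theorem covDeriv4_sub_const_mul {P Q : Fin n → Fin n → Fin n → Fin n → EuclideanSpace ℝ (Fin n) → ℝ}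
    (hP : ∀ i j k l, DifferentiableAt ℝ (P i j k l) y)
    (hQ : ∀ i j k l, DifferentiableAt ℝ (Q i j k l) y) (c : ℝ) (p i j k l : Fin n) :
    covDeriv4 G (fun i j k l x => P i j k l x - c * Q i j k l x) p i j k l y =
      covDeriv4 G P p i j k l y - c * covDeriv4 G Q p i j k l y := by
  simp only [covDeriv4, partialD_sub (hP i j k l) ((hQ i j k l).const_mul c),
    partialD_const_mul (hQ i j k l), mul_sub, Finset.mul_sum]
  rw [sub_sub_sub_comm, ← Finset.sum_sub_distrib]
  congr 1
  exact Finset.sum_congr rfl fun q _ => by ring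

/-- Absorbing the g∧g term into the second factor leaves a single Kulkarni–Nomizu product, with the
very tensor whose d^D is C. -/
theorem weyl_eq_schouten (hn : 3 ≤ n) (i j k l : Fin n) :
    weyl G i j k l y = riemann G i j k l y
      - 1 / ((n : ℝ) - 2) * kulkarniNomizu (schouten G) G i j k l y := by
  have hn' : (3 : ℝ) ≤ n := by exact_mod_cast hn
  have h1 : (n : ℝ) - 1 ≠ 0 := by linarith
  have h2 : (n : ℝ) - 2 ≠ 0 := by linarith
  simp only [weyl, kulkarniNomizu, schouten, tracelessRicci]
  field_simp
  ring

namespace IsMetricOn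

theorem smooth_schouten (h : IsMetricOn G U) (i j : Fin n) : ContDiffOn ℝ ∞ (schouten G i j) U :=
  (h.smooth_ricci _ _).sub ((h.smooth_scalar.div_const _).mul (h.smooth _ _))

/-- Leibniz rule with Dg = 0, arranged so that the Christoffel sum is the correction term of
`covDeriv4` for the 4-tensor A⊗g. -/
theorem partialD_mul_metric (h : IsMetricOn G U) (hy : y ∈ U)
    (hA : ∀ i j, DifferentiableAt ℝ (A i j) y) (p i k j l : Fin n) :
    partialD p (fun x => A i k x * G j l x) y = covDeriv2 G A p i k y * G j l y +
      ∑ q, (christoffel G q p i y * (A q k y * G j l y) + christoffel G q p k y * (A i q y * G j l y)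
        + christoffel G q p j y * (A i k y * G q l y)
        + christoffel G q p l y * (A i k y * G j q y)) := by
  have e : ∑ q, (christoffel G q p i y * (A q k y * G j l y)
      + christoffel G q p k y * (A i q y * G j l y) + christoffel G q p j y * (A i k y * G q l y)
      + christoffel G q p l y * (A i k y * G j q y)) =
      (∑ q, (christoffel G q p i y * A q k y + christoffel G q p k y * A i q y)) * G j l y
      + A i k y * ∑ q, (christoffel G q p j y * G q l y + christoffel G q p l y * G j q y) := by
    rw [Finset.sum_mul, Finset.mul_sum, ← Finset.sum_add_distrib]
    exact Finset.sum_congr rfl fun q _ => by ring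
  rw [partialD_mul (hA i k) (h.diff hy j l), h.partialD_metric hy, covDeriv2, e]
  ring

theorem covDeriv4_kulkarniNomizu (h : IsMetricOn G U) (hy : y ∈ U)
    (hA : ∀ i j, DifferentiableAt ℝ (A i j) y) (p i j k l : Fin n) :
    covDeriv4 G (kulkarniNomizu A G) p i j k l y =
      covDeriv2 G A p i k y * G j l y + covDeriv2 G A p j l y * G i k y
      - covDeriv2 G A p i l y * G j k y - covDeriv2 G A p j k y * G i l y := by
  have hd : ∀ i k j l, DifferentiableAt ℝ (fun x => A i k x * G j l x) y := fun i k j l =>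
    (hA i k).fun_mul (h.diff hy j l)
  have e : partialD p (kulkarniNomizu A G i j k l) y =
      partialD p (fun x => A i k x * G j l x) y + partialD p (fun x => A j l x * G i k x) y
      - partialD p (fun x => A i l x * G j k x) y - partialD p (fun x => A j k x * G i l x) y := by
    unfold kulkarniNomizu
    rw [partialD_sub (((hd i k j l).fun_add (hd j l i k)).fun_sub (hd i l j k)) (hd j k i l),
      partialD_sub ((hd i k j l).fun_add (hd j l i k)) (hd i l j k),
      partialD_add (hd i k j l) (hd j l i k)]
  rw [covDeriv4, e, h.partialD_mul_metric hy hA, h.partialD_mul_metric hy hA,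
    h.partialD_mul_metric hy hA, h.partialD_mul_metric hy hA, sub_eq_iff_eq_add]
  simp only [kulkarniNomizu, mul_add, mul_sub, Finset.sum_add_distrib, Finset.sum_sub_distrib]
  ring

/-- ds = 2 div Ric gives ds/2 - ds/(2 (n - 1)). -/
theorem divergence_schouten (h : IsMetricOn G U) (hy : y ∈ U) (hn : 3 ≤ n) (j : Fin n) :
    ∑ p, ∑ q, invMetric G p q y * covDeriv2 G (schouten G) p q j y =
      ((n : ℝ) - 2) / (2 * ((n : ℝ) - 1)) * partialD j (scalar G) y := by
  have hn' : (3 : ℝ) ≤ n := by exact_mod_cast hn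
  have hs : ∀ p q, covDeriv2 G (ricci G) p q j y = covDeriv2 G (ricci G) p j q y := by
    intro p q
    rw [covDeriv2_congr (B := fun a b => ricci G b a) h.isOpen (fun x hx => h.ricci_symm hx) hy]
    simp only [covDeriv2, Finset.sum_add_distrib]
    ring
  have e1 := h.partialD_scalar hy j
  have e2 := h.contract_left hy (fun j => partialD j (scalar G) y) j
  have e3 : ∑ p, ∑ q, invMetric G p q y * (partialD p (scalar G) y * G q j y) =
      partialD j (scalar G) y := by
    rw [← h.contract_right hy (fun j => partialD j (scalar G) y) j]
    exact Finset.sum_congr rfl fun p _ => Finset.sum_congr rfl fun q _ => by rw [h.symm hy q j]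
  calc _ = ∑ p, ∑ q, invMetric G p q y * covDeriv2 G (ricci G) p j q y
        - 1 / (2 * ((n : ℝ) - 1)) *
          ∑ p, ∑ q, invMetric G p q y * (partialD p (scalar G) y * G q j y) := by
        simp only [h.covDeriv2_schouten hy, hs, Finset.mul_sum, ← Finset.sum_sub_distrib]
        exact Finset.sum_congr rfl fun p _ => Finset.sum_congr rfl fun q _ => by ring
    _ = _ := by
        rw [e3]
        have h1 : (n : ℝ) - 1 ≠ 0 := by linarith
        have : ∑ p, ∑ q, invMetric G p q y * covDeriv2 G (ricci G) p j q y =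
          partialD j (scalar G) y / 2 := by linarith
        rw [this]
        field_simp
        ring

/-- The divergence of the Weyl tensor is a multiple of the Cotton tensor. -/
theorem deltaWeyl_eq_cotton (h : IsMetricOn G U) (hy : y ∈ U) (hn : 3 ≤ n) (i j k : Fin n) :
    deltaWeyl G i j k y = -(((n : ℝ) - 3) / ((n : ℝ) - 2)) * cotton G j k i y := by
  have hn' : (3 : ℝ) ≤ n := by exact_mod_cast hn
  have h1 : (n : ℝ) - 1 ≠ 0 := by linarith
  have h2 : (n : ℝ) - 2 ≠ 0 := by linarith
  have hA : ∀ i j, DifferentiableAt ℝ (schouten G i j) y := fun i j =>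
    differentiableAt_of_contDiffOn h.isOpen (h.smooth_schouten i j) hy
  have hdR : ∀ i j k l, DifferentiableAt ℝ (riemann G i j k l) y := fun i j k l =>
    differentiableAt_of_contDiffOn h.isOpen (h.smooth_riemann i j k l) hy
  have hdK : ∀ i j k l, DifferentiableAt ℝ (kulkarniNomizu (schouten G) G i j k l) y := by
    intro i j k l
    have hd : ∀ i k j l, DifferentiableAt ℝ (fun x => schouten G i k x * G j l x) y :=
      fun i k j l => (hA i k).fun_mul (h.diff hy j l)
    exact (((hd i k j l).fun_add (hd j l i k)).fun_sub (hd i l j k)).fun_sub (hd j k i l)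
  have hW : ∀ p q, covDeriv4 G (weyl G) p q i j k y = covDeriv4 G (riemann G) p q i j k y
      - 1 / ((n : ℝ) - 2) * (covDeriv2 G (schouten G) p q j y * G i k y
        + covDeriv2 G (schouten G) p i k y * G q j y
        - covDeriv2 G (schouten G) p q k y * G i j y
        - covDeriv2 G (schouten G) p i j y * G q k y) := by
    intro p q
    rw [← h.covDeriv4_kulkarniNomizu hy hA, ← covDeriv4_sub_const_mul hdR hdK]
    exact covDeriv4_congr h.isOpen (fun x _ i j k l => weyl_eq_schouten hn i j k l) hy p q i j k
  have hc : ∀ i j k, ∑ p, ∑ q, invMetric G p q y * (covDeriv2 G (schouten G) p i k y * G q j y) =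
      covDeriv2 G (schouten G) j i k y := by
    intro i j k
    rw [← h.contract_right hy (fun p => covDeriv2 G (schouten G) p i k y) j]
    exact Finset.sum_congr rfl fun p _ => Finset.sum_congr rfl fun q _ => by rw [h.symm hy q j]
  have hs : ∀ p a b, covDeriv2 G (schouten G) p a b y = covDeriv2 G (schouten G) p b a y := by
    intro p a b
    rw [covDeriv2_congr (B := fun a b => schouten G b a) h.isOpen
      (fun x hx a b => by rw [schouten, schouten, h.ricci_symm hx a b, h.symm hx a b]) hy]
    simp only [covDeriv2, Finset.sum_add_distrib]
    ring
  have e : ∑ p, ∑ q, invMetric G p q y * covDeriv4 G (weyl G) p q i j k y =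
      ∑ p, ∑ q, invMetric G p q y * covDeriv4 G (riemann G) p q i j k y
      - 1 / ((n : ℝ) - 2) *
        ((∑ p, ∑ q, invMetric G p q y * covDeriv2 G (schouten G) p q j y) * G i k y
        + ∑ p, ∑ q, invMetric G p q y * (covDeriv2 G (schouten G) p i k y * G q j y)
        - (∑ p, ∑ q, invMetric G p q y * covDeriv2 G (schouten G) p q k y) * G i j y
        - ∑ p, ∑ q, invMetric G p q y * (covDeriv2 G (schouten G) p i j y * G q k y)) := by
    simp only [hW, Finset.mul_sum, Finset.sum_mul, ← Finset.sum_sub_distrib,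
      ← Finset.sum_add_distrib]
    exact Finset.sum_congr rfl fun p _ => Finset.sum_congr rfl fun q _ => by ring
  have hC : cotton G j k i y = covDeriv2 G (schouten G) j k i y - covDeriv2 G (schouten G) k j i y :=
    rfl
  have hR : ∀ p a b, covDeriv2 G (ricci G) p a b y = covDeriv2 G (schouten G) p a b y
      + partialD p (scalar G) y / (2 * ((n : ℝ) - 1)) * G a b y := fun p a b => by
    rw [h.covDeriv2_schouten hy]; ring
  -- The divergence of R is C plus ds∧g / (2 (n - 1)). The Kulkarni–Nomizu part subtracts C / (n -
  -- 2) and the same multiple of ds∧g, so only the coefficient 1 - 1/(n - 2) of C survives.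
  rw [deltaWeyl, e, h.div_riemann hy, h.divergence_schouten hy hn, h.divergence_schouten hy hn,
    hc, hc, hC, hR, hR, hs j i k, hs k i j, h.symm hy k i, h.symm hy j i]
  field_simp
  ring

theorem deltaWeyl_eq_zero (h : IsMetricOn G U) (hn : 3 ≤ n)
    (hC : ∀ y ∈ U, ∀ i j k, cotton G i j k y = 0) (hy : y ∈ U) (i j k : Fin n) :
    deltaWeyl G i j k y = 0 := by
  rw [h.deltaWeyl_eq_cotton hy hn, hC y hy, mul_zero]

theorem bach_eq_zero (h : IsMetricOn G U) (hn : 3 ≤ n)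
    (hC : ∀ y ∈ U, ∀ i j k, cotton G i j k y = 0)
    (hW : ∀ y ∈ U, ∀ i j, weylRing G i j y = 0) (hy : y ∈ U) (i j : Fin n) :
    bach G i j y = 0 := by
  have h0 : ∀ x ∈ U, ∀ a b c, deltaWeyl G a b c x = 0 :=
    fun x hx a b c => h.deltaWeyl_eq_zero hn hC hx a b c
  have hd : deltaD G (fun a b c => deltaWeyl G c a b) i j y = 0 := by
    have hc : ∀ p q, covDeriv3 G (fun a b c => deltaWeyl G c a b) p q i j y = 0 := by
      intro p q
      have : partialD p (deltaWeyl G j q i) y = 0 := by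
        rw [partialD_congr h.isOpen (fun x hx => h0 x hx j q i) hy, partialD_const]
      simp [covDeriv3, this, h0 y hy]
    simp [deltaD, hc]
  simp [bach, hd, hW y hy]

end IsMetricOn

end DivergenceWeyl

/-! ### Local unique continuation for Ddu = u A. -/

section UniqueContinuation

variable {n : ℕ} {G : Fin n → Fin n → EuclideanSpace ℝ (Fin n) → ℝ}
  {U : Set (EuclideanSpace ℝ (Fin n))} {y : EuclideanSpace ℝ (Fin n)}
  {u : EuclideanSpace ℝ (Fin n) → ℝ}

theorem fderiv_eq_sum_partialD (φ : EuclideanSpace ℝ (Fin n) → ℝ) (x v : EuclideanSpace ℝ (Fin n)) :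
    fderiv ℝ φ x v = ∑ j, v j * partialD j φ x := by
  conv_lhs => rw [← (EuclideanSpace.basisFun (Fin n) ℝ).sum_repr v]
  simp [partialD]

/-- A function with `Ddu = u A` whose `1`-jet vanishes at a point vanishes near this point. -/
theorem IsMetricOn.eventually_eq_zero_of_hessian (h : IsMetricOn G U) (hu : ContDiffOn ℝ ∞ u U)
    {A : Fin n → Fin n → EuclideanSpace ℝ (Fin n) → ℝ} (hA : ∀ i j, ContinuousOn (A i j) U)
    (hE : ∀ y ∈ U, ∀ i j, hessian G u i j y = u y * A i j y) (hy : y ∈ U)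
    (h0 : u y = 0) (h1 : ∀ i, partialD i u y = 0) : ∀ᶠ x in 𝓝 y, u x = 0 := by
  obtain ⟨r, hr, hrU⟩ := Metric.nhds_basis_closedBall.mem_iff.mp (h.isOpen.mem_nhds hy)
  -- All coefficients are bundled into one continuous map, so that compactness of the ball yields
  -- one common bound `K`.
  let Φ : EuclideanSpace ℝ (Fin n) → (Fin n → Fin n → ℝ) × (Fin n → Fin n → Fin n → ℝ) :=
    fun x => (fun i j => A i j x, fun k i j => christoffel G k i j x)
  have hΦ : ContinuousOn Φ (Metric.closedBall y r) := by
    refine ContinuousOn.mono ?_ hrU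
    exact ContinuousOn.prodMk (continuousOn_pi.mpr fun i => continuousOn_pi.mpr fun j => hA i j)
      (continuousOn_pi.mpr fun k => continuousOn_pi.mpr fun i => continuousOn_pi.mpr fun j =>
        (h.smooth_christoffel k i j).continuousOn)
  obtain ⟨K, hK⟩ := (isCompact_closedBall y r).exists_bound_of_continuousOn hΦ
  have hKA : ∀ x ∈ Metric.closedBall y r, ∀ i j, |A i j x| ≤ K := fun x hx i j =>
    (norm_le_pi_norm (fun j => A i j x) j).trans ((norm_le_pi_norm (Φ x).1 i).trans
      ((norm_fst_le (Φ x)).trans (hK x hx)))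
  have hKΓ : ∀ x ∈ Metric.closedBall y r, ∀ k i j, |christoffel G k i j x| ≤ K :=
    fun x hx k i j =>
    (norm_le_pi_norm (fun j => christoffel G k i j x) j).trans
      ((norm_le_pi_norm ((Φ x).2 k) i).trans ((norm_le_pi_norm (Φ x).2 k).trans
      ((norm_snd_le (Φ x)).trans (hK x hx))))
  have hK0 : 0 ≤ K := (norm_nonneg _).trans (hK y (Metric.mem_closedBall_self hr.le))
  refine Filter.mem_of_superset (Metric.closedBall_mem_nhds y hr) fun x hx => ?_
  let v := x - y
  have hv : ‖v‖ ≤ r := by simpa [v, dist_eq_norm] using hx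
  let γ : ℝ → EuclideanSpace ℝ (Fin n) := fun t => y + t • v
  have hγ : ∀ t ∈ Set.Icc (0 : ℝ) 1, γ t ∈ Metric.closedBall y r := by
    intro t ht
    simp only [γ, Metric.mem_closedBall, dist_eq_norm, add_sub_cancel_left, norm_smul,
      Real.norm_eq_abs, abs_of_nonneg ht.1]
    exact (mul_le_of_le_one_left (norm_nonneg _) ht.2).trans hv
  have hγ' : ∀ t, HasDerivAt γ v t := fun t => by
    have := ((hasDerivAt_id t).smul_const v).const_add y
    rwa [one_smul] at this
  have hcomp : ∀ φ : EuclideanSpace ℝ (Fin n) → ℝ, ContDiffOn ℝ ∞ φ U → ∀ t ∈ Set.Icc (0 : ℝ) 1,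
      HasDerivAt (fun t => φ (γ t)) (∑ j, v j * partialD j φ (γ t)) t := by
    intro φ hφ t ht
    rw [← fderiv_eq_sum_partialD]
    exact (differentiableAt_of_contDiffOn h.isOpen hφ (hrU (hγ t ht))).hasFDerivAt.comp_hasDerivAt
      t (hγ' t)
  -- The 1-jet of u along the segment from y to x. The Hessian equation expresses second derivatives
  -- linearly through it, so w satisfies a linear differential inequality.
  let w : ℝ → ℝ × (Fin n → ℝ) := fun t => (u (γ t), fun i => partialD i u (γ t))
  let w' : ℝ → ℝ × (Fin n → ℝ) := fun t => (∑ j, v j * partialD j u (γ t),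
    fun i => ∑ j, v j * partialD j (partialD i u) (γ t))
  have hw : ∀ t ∈ Set.Icc (0 : ℝ) 1, HasDerivAt w (w' t) t := fun t ht =>
    (hcomp u hu t ht).prodMk (hasDerivAt_pi.mpr fun i =>
      hcomp _ (contDiffOn_partialD h.isOpen hu i) t ht)
  have hvj : ∀ j, |v j| ≤ r := fun j => (PiLp.norm_apply_le v j).trans hv
  have hsum : ∀ (a : Fin n → ℝ) (C : ℝ), (∀ j, |a j| ≤ C) → |∑ j, v j * a j| ≤ n * (r * C) := by
    intro a C ha
    refine (Finset.abs_sum_le_sum_abs _ _).trans ?_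
    refine (Finset.sum_le_sum fun j _ => ?_).trans_eq (b := ∑ _j : Fin n, r * C) (by simp)
    rw [abs_mul]
    exact mul_le_mul (hvj j) (ha j) (abs_nonneg _) hr.le
  -- The factor n r comes from summing over the components of v. In the bracket, 1 covers ∂u, K the
  -- term u A, and n K the Christoffel terms.
  have bound : ∀ t ∈ Set.Ico (0 : ℝ) 1, ‖w' t‖ ≤ (n * (r * (1 + K + n * K))) * ‖w t‖ := by
    intro t ht
    have hb := hγ t ⟨ht.1, ht.2.le⟩
    have hN : 0 ≤ ‖w t‖ := norm_nonneg _
    have b0 : |u (γ t)| ≤ ‖w t‖ := norm_fst_le (w t)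
    have b1 : ∀ i, |partialD i u (γ t)| ≤ ‖w t‖ := fun i =>
      (norm_le_pi_norm (w t).2 i).trans (norm_snd_le (w t))
    have hnK : 0 ≤ (n : ℝ) * K := by positivity
    have b2 : ∀ i j, |partialD j (partialD i u) (γ t)| ≤ (1 + K + n * K) * ‖w t‖ := by
      intro i j
      have e : partialD j (partialD i u) (γ t) = u (γ t) * A j i (γ t)
          + ∑ k, christoffel G k j i (γ t) * partialD k u (γ t) := by
        rw [← hE _ (hrU hb), hessian]; ring
      rw [e]
      refine (abs_add_le _ _).trans ?_
      have c1 : |u (γ t) * A j i (γ t)| ≤ ‖w t‖ * K := by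
        rw [abs_mul]
        exact mul_le_mul b0 (hKA _ hb _ _) (abs_nonneg _) hN
      have c2 : |∑ k, christoffel G k j i (γ t) * partialD k u (γ t)| ≤ n * (K * ‖w t‖) := by
        refine (Finset.abs_sum_le_sum_abs _ _).trans ?_
        refine (Finset.sum_le_sum fun k _ => ?_).trans_eq (b := ∑ _k : Fin n, K * ‖w t‖) (by simp)
        rw [abs_mul]
        exact mul_le_mul (hKΓ _ hb _ _ _) (b1 k) (abs_nonneg _) hK0
      linarith
    rw [mul_assoc, mul_assoc]
    refine norm_prod_le_iff.mpr ⟨hsum _ _ fun j => ?_, (pi_norm_le_iff_of_nonneg (by positivity)).mpr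
      fun i => hsum _ _ (b2 i)⟩
    exact (b1 j).trans (le_mul_of_one_le_left hN (by linarith))
  -- Grönwall's inequality with w(0) = 0, read off at time 1, where the segment reaches x.
  have hz := eq_zero_of_abs_deriv_le_mul_abs_self_of_eq_zero_right (f := w) (f' := w')
    (fun t ht => (hw t ht).continuousAt.continuousWithinAt)
    (fun t ht => (hw t ⟨ht.1, ht.2.le⟩).hasDerivWithinAt)
    (by ext i <;> simp [w, γ, h0, h1]) bound 1 (by simp)
  have := congrArg Prod.fst hz
  simpa [w, γ, v] using this

end UniqueContinuation

/-! ### Smoothness of coordinate vector fields and of metric components. -/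

section ChartDerivative

variable {E : Type*} [NormedAddCommGroup E] [NormedSpace ℝ E] {M : Type*} [TopologicalSpace M]
  [ChartedSpace E M] {e : OpenPartialHomeomorph M E}

/-- The field is the tangent map of the inverse chart applied to a constant vector field. -/
theorem contMDiffOn_mfderiv_symm [IsManifold 𝓘(ℝ, E) ∞ M]
    (he : e ∈ IsManifold.maximalAtlas 𝓘(ℝ, E) ∞ M) (v : E) :
    ContMDiffOn 𝓘(ℝ, E) 𝓘(ℝ, E).tangent ∞
      (fun y => (⟨e.symm y, mfderiv 𝓘(ℝ, E) 𝓘(ℝ, E) e.symm y v⟩ : TangentBundle 𝓘(ℝ, E) M))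
      e.target := by
  have h1 := (contMDiffOn_symm_of_mem_maximalAtlas he).contMDiffOn_tangentMapWithin
    (m := ∞) (by simp) e.open_target.uniqueMDiffOn
  have h2 : ContMDiff 𝓘(ℝ, E) 𝓘(ℝ, E).tangent ∞
      (fun y => (⟨y, v⟩ : TangentBundle 𝓘(ℝ, E) E)) :=
    contMDiff_vectorSpace_iff_contDiff.mpr contDiff_const
  refine (h1.comp h2.contMDiffOn (fun y hy => hy)).congr fun y hy => ?_
  simp only [Function.comp, tangentMapWithin]
  rw [mfderivWithin_of_isOpen e.open_target hy]

theorem mfderiv_symm_injective (he : e ∈ IsManifold.maximalAtlas 𝓘(ℝ, E) ∞ M) {y : E}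
    (hy : y ∈ e.target) : Function.Injective (mfderiv 𝓘(ℝ, E) 𝓘(ℝ, E) e.symm y) := by
  have hm : e.MDifferentiable 𝓘(ℝ, E) 𝓘(ℝ, E) :=
    ⟨(contMDiffOn_of_mem_maximalAtlas he).mdifferentiableOn (by simp),
      (contMDiffOn_symm_of_mem_maximalAtlas he).mdifferentiableOn (by simp)⟩
  exact hm.symm.mfderiv_injective hy

theorem contDiffOn_inner_mfderiv_symm [IsManifold 𝓘(ℝ, E) ∞ M]
    (g : Bundle.ContMDiffRiemannianMetric 𝓘(ℝ, E) ∞ E (fun x : M => TangentSpace 𝓘(ℝ, E) x))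
    (he : e ∈ IsManifold.maximalAtlas 𝓘(ℝ, E) ∞ M) (v w : E) :
    ContDiffOn ℝ ∞ (fun y => g.inner (e.symm y) (mfderiv 𝓘(ℝ, E) 𝓘(ℝ, E) e.symm y v)
      (mfderiv 𝓘(ℝ, E) 𝓘(ℝ, E) e.symm y w)) e.target := by
  rw [← contMDiffOn_iff_contDiffOn]
  intro y hy
  -- The function is viewed as a section of the trivial line bundle, so that evaluation of the
  -- bundle-valued bilinear form is smooth in all its arguments.
  have : ContMDiffWithinAt 𝓘(ℝ, E) (𝓘(ℝ, E).prod 𝓘(ℝ)) ∞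
      (fun y => Bundle.TotalSpace.mk' ℝ (E := Bundle.Trivial M ℝ) (e.symm y)
        (g.inner (e.symm y) (mfderiv 𝓘(ℝ, E) 𝓘(ℝ, E) e.symm y v)
          (mfderiv 𝓘(ℝ, E) 𝓘(ℝ, E) e.symm y w))) e.target y := by
    apply ContMDiffWithinAt.clm_bundle_apply₂ (F₁ := E) (F₂ := E)
      (E₁ := fun x : M => TangentSpace 𝓘(ℝ, E) x) (E₂ := fun x : M => TangentSpace 𝓘(ℝ, E) x)
    · exact ContMDiffAt.comp_contMDiffWithinAt y g.contMDiff.contMDiffAt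
        (contMDiffOn_symm_of_mem_maximalAtlas he y hy)
    · exact contMDiffOn_mfderiv_symm he v y hy
    · exact contMDiffOn_mfderiv_symm he w y hy
  simp only [Bundle.contMDiffWithinAt_totalSpace] at this
  exact this.2

end ChartDerivative

/-! ### Passage from the manifold to charts, and global nonvanishing of f. -/

section Manifold

variable {n : ℕ} {M : Type*} [TopologicalSpace M] [ChartedSpace (EuclideanSpace ℝ (Fin n)) M]
  {e : OpenPartialHomeomorph M (EuclideanSpace ℝ (Fin n))}

theorem contDiffOn_comp_symm {f : M → ℝ} (hf : ContMDiff (𝓡 n) 𝓘(ℝ, ℝ) ∞ f)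
    (he : e ∈ IsManifold.maximalAtlas (𝓡 n) ∞ M) : ContDiffOn ℝ ∞ (f ∘ e.symm) e.target :=
  (hf.comp_contMDiffOn (contMDiffOn_symm_of_mem_maximalAtlas he)).contDiffOn

variable [IsManifold (𝓡 n) ∞ M]

/-- The bridge to the coordinate calculus. The matrix of components evaluates g on Σ aᵢ∂ᵢ, which is
nonzero for a ≠ 0 because the derivative of the inverse chart is injective. -/
theorem isMetricOn_metricComp (g : Metric n M) (he : e ∈ IsManifold.maximalAtlas (𝓡 n) ∞ M) :
    IsMetricOn (metricComp g e) e.target := by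
  refine ⟨e.open_target, fun i j => contDiffOn_inner_mfderiv_symm g he _ _, fun y hy => ?_⟩
  have hlin : ∀ a : Fin n → ℝ, ∑ i, a i • coordVec e i y =
      mfderiv (𝓡 n) (𝓡 n) e.symm y (WithLp.toLp 2 a : EuclideanSpace ℝ (Fin n)) := by
    intro a
    have ha : (WithLp.toLp 2 a : EuclideanSpace ℝ (Fin n)) =
        ∑ i, a i • (EuclideanSpace.single i (1 : ℝ) : EuclideanSpace ℝ (Fin n)) := by
      simpa using ((EuclideanSpace.basisFun (Fin n) ℝ).sum_repr (WithLp.toLp 2 a)).symm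
    rw [ha]
    exact ((map_sum (mfderiv (𝓡 n) (𝓡 n) e.symm y) _ _).trans
      (Finset.sum_congr rfl fun i _ => map_smul (mfderiv (𝓡 n) (𝓡 n) e.symm y) _ _)).symm
  refine Matrix.PosDef.of_dotProduct_mulVec_pos ?_ fun a ha => ?_
  · ext i j
    exact g.symm _ _ _
  · have e1 : star a ⬝ᵥ (Matrix.of fun i j => metricComp g e i j y).mulVec a =
        g.inner (e.symm y) (∑ i, a i • coordVec e i y) (∑ i, a i • coordVec e i y) := by
      simp only [map_sum, map_smul, FunLike.coe_sum, Finset.sum_apply, FunLike.coe_smul,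
        Pi.smul_apply, smul_eq_mul, dotProduct, Matrix.mulVec, Pi.star_apply, star_trivial,
        Matrix.of_apply, metricComp, Finset.mul_sum]
      rw [Finset.sum_comm]
      exact Finset.sum_congr rfl fun i _ => Finset.sum_congr rfl fun j _ => by rw [g.symm]; ring
    rw [e1]
    refine g.pos _ _ fun h0 => ha ?_
    rw [hlin] at h0
    have h2 := mfderiv_symm_injective he hy (h0.trans (map_zero _).symm)
    exact congrArg (WithLp.ofLp (p := 2) (V := Fin n → ℝ)) h2

/-- On a connected manifold, a nontrivial solution of the generalized Einstein equation does not
vanish on any nonempty open set. -/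
theorem IsGeneralizedEinstein.not_eventually_eq_zero [ConnectedSpace M] {g : Metric n M}
    {f lam : M → ℝ} {m : ℝ} (hE : IsGeneralizedEinstein g f lam m) (hf : ∃ x, f x ≠ 0) (x : M) :
    ¬ ∀ᶠ z in 𝓝 x, f z = 0 := by
  let S : Set M := {x | ∀ᶠ z in 𝓝 x, f z = 0}
  have hSo : IsOpen S := isOpen_setOfPred_eventually_nhds
  -- At a limit point of S the 1-jet of f vanishes by continuity, and local unique continuation then
  -- makes f vanish nearby.
  have hSc : IsClosed S := by
    refine isClosed_of_closure_subset fun x hx => ?_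
    let e := chartAt (EuclideanSpace ℝ (Fin n)) x
    have he : e ∈ IsManifold.maximalAtlas (𝓡 n) ∞ M := IsManifold.chart_mem_maximalAtlas x
    have hxs : x ∈ e.source := mem_chart_source _ x
    have h := isMetricOn_metricComp g he
    have hu := contDiffOn_comp_symm hE.smooth_f he
    have hL := contDiffOn_comp_symm hE.smooth_lam he
    have hy : e x ∈ e.target := e.map_source hxs
    have hev : ∀ x' ∈ S, x' ∈ e.source → ∀ᶠ z in 𝓝 (e x'), (f ∘ e.symm) z = 0 := by
      intro x' hx' hs
      have := (e.symm.continuousAt (e.map_source hs)).tendsto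
      rw [e.left_inv hs] at this
      exact this.eventually hx'
    have hclos : ∀ φ : EuclideanSpace ℝ (Fin n) → ℝ, ContDiffOn ℝ ∞ φ e.target →
        (∀ x' ∈ S, x' ∈ e.source → φ (e x') = 0) → φ (e x) = 0 := by
      intro φ hφ h0
      by_contra hne
      have hc : ContinuousAt (φ ∘ e) x :=
        (hφ.continuousOn.continuousAt (e.open_target.mem_nhds hy)).comp (e.continuousAt hxs)
      obtain ⟨x', ⟨h1, h2⟩, h3⟩ := mem_closure_iff_nhds.mp hx _
        ((hc.eventually_ne hne).and (e.open_source.mem_nhds hxs))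
      exact h1 (h0 x' h3 h2)
    have h0 : (f ∘ e.symm) (e x) = 0 := hclos _ hu fun x' hx' hs => (hev x' hx' hs).self_of_nhds
    have h1 : ∀ i, partialD i (f ∘ e.symm) (e x) = 0 := fun i =>
      hclos _ (contDiffOn_partialD e.open_target hu i) fun x' hx' hs => by
        have : (f ∘ e.symm) =ᶠ[𝓝 (e x')] fun _ => 0 := hev x' hx' hs
        simp [partialD, this.fderiv_eq]
    have hz := h.eventually_eq_zero_of_hessian hu (A := fun i j y => m⁻¹ *
        (ricci (metricComp g e) i j y - (lam ∘ e.symm) y * metricComp g e i j y))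
      (fun i j => continuousOn_const.mul ((h.smooth_ricci i j).continuousOn.sub
        (hL.continuousOn.mul (h.smooth i j).continuousOn)))
      (fun y hy i j => by
        rw [hE.equation e he y hy]
        simp only [Function.comp]
        ring) hy h0 h1
    filter_upwards [(e.continuousAt hxs).eventually hz, e.open_source.mem_nhds hxs] with z h1 h2
    simpa [e.left_inv h2] using h1
  intro hx
  have : S = Set.univ := IsClopen.eq_univ ⟨hSc, hSo⟩ ⟨x, hx⟩
  obtain ⟨z, hz⟩ := hf
  have hzS : z ∈ S := this ▸ Set.mem_univ z
  exact hz hzS.self_of_nhds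

end Manifold

end RiemChart

/-! ### The theorem, assembled chart by chart. -/

theorem mainTheorem7 {n : ℕ} (hn : 3 ≤ n)
    {M : Type*} [TopologicalSpace M] [ChartedSpace (EuclideanSpace ℝ (Fin n)) M]
    [IsManifold (𝓡 n) ∞ M] [T2Space M] [CompactSpace M] [ConnectedSpace M]
    (g : RiemChart.Metric n M) (f lam : M → ℝ) (m : ℝ)
    (hE : RiemChart.IsGeneralizedEinstein g f lam m)
    (hf : ∃ x, f x ≠ 0)
    (hT : RiemChart.StructureTensorVanishes g f) :
    RiemChart.CottonVanishes g ∧ RiemChart.HarmonicWeyl g ∧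
      (4 ≤ n → RiemChart.BachFlat g) := by
  have key : ∀ e ∈ IsManifold.maximalAtlas (𝓡 n) ∞ M,
      (∀ y ∈ e.target, ∀ i j k, RiemChart.cotton (RiemChart.metricComp g e) i j k y = 0) ∧
      (∀ y ∈ e.target, ∀ i j, RiemChart.weylRing (RiemChart.metricComp g e) i j y = 0) := by
    intro e he
    have h := RiemChart.isMetricOn_metricComp g he
    have hu := RiemChart.contDiffOn_comp_symm hE.smooth_f he
    have hL := RiemChart.contDiffOn_comp_symm hE.smooth_lam he
    -- A zero of f ∘ e⁻¹ on an open set of coordinates pulls back through e to a zero of f on an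
    -- open set of M.
    have hnz : ∀ y ∈ e.target, ¬ ∀ᶠ x in nhds y, (f ∘ e.symm) x = 0 := by
      intro y hy hev
      refine hE.not_eventually_eq_zero hf (e.symm y) ?_
      have hs := e.map_target hy
      have hc := (e.continuousAt hs).tendsto
      rw [e.right_inv hy] at hc
      filter_upwards [hc.eventually hev, e.open_source.mem_nhds hs] with z h1 h2
      simpa [e.left_inv h2] using h1
    exact ⟨fun y hy => h.cotton_eq_zero hn hE.m_pos.ne' hu hL (hE.equation e he) (hT e he) hnz hy,
      fun y hy => h.weylRing_eq_zero hn hE.m_pos.ne' hu hL (hE.equation e he) (hT e he) hnz hy⟩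
  refine ⟨fun e he => (key e he).1, fun e he y hy => ?_, fun _ e he y hy => ?_⟩
  · exact (RiemChart.isMetricOn_metricComp g he).deltaWeyl_eq_zero hn (key e he).1 hy
  · exact (RiemChart.isMetricOn_metricComp g he).bach_eq_zero hn (key e he).1 (key e he).2 hy
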